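/- Let $\mathbb K\in\{\mathbb R,\mathbb C\}$, $m\ge 0$, $X=\{x_0,\dots,x_m\}$, and let $X^*$ be the set of words over $X$. A series $c\in\mathbb K^m\langle\langle X\rangle\rangle$ is a map $X^*\to\mathbb K^m$, $\eta\mapsto(c,\eta)$, with components $c[1],\dots,c[m]$; put $c[0]:=0$. Let $\mathbb K^m_{LC}\langle\langle X\rangle\rangle$ be the space of series with $|(c,\eta)|\le KM^{|\eta|}|\eta|!$ for all $\eta$ and some $K,M\ge 0$ (where $|\cdot|$ on $\mathbb K^m$ is the maximum norm), with the Silva topology, i.e. the locally convex inductive limit topology of the Banach spaces $\ell_{\infty,M}=\{c:\ \sup_\eta |(c,\eta)|/(M^{|\eta|}|\eta|!)<\infty\}$, $M>0$. Let $\sqcup\!\sqcup$ denote the shuffle product of scalar series, the bilinear extension of $(x_i\eta)\sqcup\!\sqcup(x_j\xi)=x_i(\eta\sqcup\!\sqcup(x_j\xi))+x_j((x_i\eta)\sqcup\!\sqcup\xi)$, $\eta\sqcup\!\sqcup\emptyset=\emptyset\sqcup\!\sqcup\eta=\eta$. On the set $\delta+\mathbb K^m_{LC}\langle\langle X\rangle\rangle$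 of formal symbols $\delta+c$ consider $$(\delta+c)\circ(\delta+d)=\delta+d+\sum_{\eta\in X^*}(c,\eta)\,\phi_d(\eta)(\mathbf 1),$$ where $\phi_d(\emptyset)=\mathrm{id}$, $\phi_d(x_i\eta)=\phi_d(x_i)\circ\phi_d(\eta)$, $\phi_d(x_i)(e)=x_ie+x_0(d[i]\sqcup\!\sqcup e)$ for scalar series $e$, and $\mathbf 1$ is the empty word regarded as a series. The pre-Lie product is $c\lhd d=\sum_{\eta}(c,\eta)\,(\eta\lhd d)$, where $\emptyset\lhd d=0$ and $(x_i\eta)\lhd d=x_i(\eta\lhd d)+x_0(\eta\sqcup\!\sqcup d[i])$ for $0\le i\le m$. Then $(\delta+\mathbb K^m_{LC}\langle\langle X\rangle\rangle,\circ,\delta)$ is a $\mathbb K$-smooth locally convex Lie group with the global chart $\delta+c\mapsto c$, and its Lie algebra (the tangent space at $\delta$ with the bracket $[v,w]=[X^v,X^w](\delta)$, where $X^v$ is the left invariant vector field with value $v$ at $\delta$ and $[X,Y]=dY\circ X-dX\circ Y$) is $\mathbb K^m_{LC}\langle\langle X\rangle\rangle$ with the Lie bracket $$[c,d]=c\lhd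 d-d\lhd c .$$ -/

import Mathlib

open Filter Topology
open scoped ENNReal

noncomputable section

/-! ## Words and formal power series -/

/-- Words over the alphabet `{x_0, ..., x_m}`; the letter `x_i` is `i : Fin (m + 1)`. -/
abbrev Word (m : ℕ) := List (Fin (m + 1))

/-- Scalar formal power series: a series is the family of its coefficients. -/
abbrev ScalarSeries (𝕜 : Type*) (m : ℕ) := Word m → 𝕜

/-- Formal power series with coefficients in `𝕜 ^ m`, over the alphabet `{x_0, ..., x_m}`.
The coefficient space `Fin m → 𝕜` carries the maximum norm. -/
abbrev Series (𝕜 : Type*) (m : ℕ) := Word m → Fin m → 𝕜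

namespace Series

/-- The shuffle of two words, as a multiset of words. -/
def shuffleWords {α : Type*} : List α → List α → Multiset (List α)
  | [], ξ => {ξ}
  | η, [] => {η}
  | x :: η, y :: ξ =>
      (shuffleWords η (y :: ξ)).map (List.cons x) + (shuffleWords (x :: η) ξ).map (List.cons y)
termination_by η ξ => η.length + ξ.length

theorem length_of_mem_shuffleWords {α : Type*} (η ξ : List α) :
    ∀ ζ ∈ shuffleWords η ξ, ζ.length = η.length + ξ.length := by
  induction η, ξ using shuffleWords.induct with
  | case1 ξ => simp [shuffleWords]
  | case2 η h =>
    cases η with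
    | nil => simp [shuffleWords]
    | cons a η => simp [shuffleWords]
  | case3 x η y ξ ih1 ih2 =>
    intro ζ hζ
    rw [shuffleWords, Multiset.mem_add, Multiset.mem_map, Multiset.mem_map] at hζ
    rcases hζ with ⟨a, ha, rfl⟩ | ⟨a, ha, rfl⟩
    · have := ih1 a ha
      simp only [List.length_cons] at this ⊢
      omega
    · have := ih2 a ha
      simp only [List.length_cons] at this ⊢
      omega

variable {𝕜 : Type*} [RCLike 𝕜] {m : ℕ}

open Classical in
/-- The shuffle product of scalar series, the bilinear extension of the shuffle of words. For a
given `ζ` only the finitely many pairs of words of total length `ζ.length` contribute. -/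
def shuffle (c d : ScalarSeries 𝕜 m) : ScalarSeries 𝕜 m := fun ζ =>
  ∑ᶠ p : Word m × Word m, c p.1 * d p.2 * ((shuffleWords p.1 p.2).count ζ : 𝕜)

/-- The series consisting of the single word `η`. -/
def mono (η : Word m) : ScalarSeries 𝕜 m := Pi.single η 1

/-- The catenation `x c` of a letter and a series. -/
def letterMul (x : Fin (m + 1)) (c : ScalarSeries 𝕜 m) : ScalarSeries 𝕜 m
  | [] => 0
  | y :: ζ => if y = x then c ζ else 0

/-- The component series `d[i]` for `i = 1, ..., m`, with the convention `d[0] = 0`. -/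
def component (d : Series 𝕜 m) (i : Fin (m + 1)) : ScalarSeries 𝕜 m := fun ζ =>
  Fin.cases 0 (fun j => d ζ j) i

/-! ### The mixed composition product and the group product -/

/-- The endomorphism `φ_d(η)` of the space of scalar series: `φ_d` of the empty word is the
identity and `φ_d(x_i η) = φ_d(x_i) ∘ φ_d(η)`, `φ_d(x_i)(e) = x_i e + x_0 (d[i] ⧢ e)`. -/
def phi (d : Series 𝕜 m) : Word m → ScalarSeries 𝕜 m → ScalarSeries 𝕜 m
  | [], e => e
  | i :: η, e =>
      letterMul i (phi d η e) + letterMul 0 (shuffle (component d i) (phi d η e))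

/-- The mixed composition product of `c` with `δ + d`, that is
`∑ η, (c, η) φ_d(η)(1)`, a locally finite sum. -/
def mixedComp (c d : Series 𝕜 m) : Series 𝕜 m := fun ζ =>
  ∑ᶠ η : Word m, phi d η (mono []) ζ • c η

/-- `(δ + c) ∘ (δ + d) = δ + groupProd c d`. -/
def groupProd (c d : Series 𝕜 m) : Series 𝕜 m := d + mixedComp c d

/-! ### The pre-Lie product -/

/-- The series `η ◁ d` for a word `η`. -/
def wordPreLie (d : Series 𝕜 m) : Word m → ScalarSeries 𝕜 m
  | [] => 0
  | i :: η => letterMul i (wordPreLie d η) + letterMul 0 (shuffle (mono η) (component d i))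

/-- The pre-Lie product `c ◁ d = ∑ η, (c, η) (η ◁ d)`, a locally finite sum. -/
def preLie (c d : Series 𝕜 m) : Series 𝕜 m := fun ζ =>
  ∑ᶠ η : Word m, wordPreLie d η ζ • c η

/-! ### Local finiteness of the sums above -/

theorem shuffle_support_finite (c d : ScalarSeries 𝕜 m) (ζ : Word m) [DecidableEq (Word m)] :
    (Function.support fun p : Word m × Word m =>
      c p.1 * d p.2 * ((shuffleWords p.1 p.2).count ζ : 𝕜)).Finite := by
  refine ((List.finite_length_le (Fin (m + 1)) ζ.length).prod
    (List.finite_length_le (Fin (m + 1)) ζ.length)).subset ?_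
  intro p hp
  have hc : (shuffleWords p.1 p.2).count ζ ≠ 0 := by
    intro h
    exact hp (by simp [h])
  have hl := length_of_mem_shuffleWords p.1 p.2 ζ (Multiset.count_ne_zero.mp hc)
  simp only [Set.mem_prod, Set.mem_ofPred_eq]
  omega

theorem shuffle_eq_zero {c d : ScalarSeries 𝕜 m} {ζ : Word m}
    (h : ∀ p q : Word m, p.length + q.length = ζ.length → c p * d q = 0) :
    shuffle c d ζ = 0 := by
  classical
  unfold shuffle
  refine finsum_eq_zero_of_forall_eq_zero fun p => ?_
  by_cases hp : ζ ∈ shuffleWords p.1 p.2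
  · rw [h p.1 p.2 (length_of_mem_shuffleWords _ _ _ hp).symm, zero_mul]
  · rw [Multiset.count_eq_zero_of_notMem hp, Nat.cast_zero, mul_zero]

theorem phi_eq_zero_of_length_lt (d : Series 𝕜 m) (e : ScalarSeries 𝕜 m) (η : Word m) :
    ∀ ζ : Word m, ζ.length < η.length → phi d η e ζ = 0 := by
  induction η with
  | nil => intro ζ h; simp at h
  | cons i η ih =>
    intro ζ h
    cases ζ with
    | nil => simp [phi, letterMul]
    | cons y ζ =>
      have h' : ζ.length < η.length := by simpa using h
      have h2 : shuffle (component d i) (phi d η e) ζ = 0 :=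
        shuffle_eq_zero fun p q hpq => by rw [ih q (by omega), mul_zero]
      simp [phi, letterMul, ih ζ h', h2]

theorem wordPreLie_eq_zero_of_length_lt (d : Series 𝕜 m) (η : Word m) :
    ∀ ζ : Word m, ζ.length < η.length → wordPreLie d η ζ = 0 := by
  induction η with
  | nil => intro ζ h; simp at h
  | cons i η ih =>
    intro ζ h
    cases ζ with
    | nil => simp [wordPreLie, letterMul]
    | cons y ζ =>
      have h' : ζ.length < η.length := by simpa using h
      have h2 : shuffle (mono η) (component d i) ζ = 0 :=
        shuffle_eq_zero fun p q hpq => by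
          have : p ≠ η := by rintro rfl; omega
          simp [mono, Pi.single_eq_of_ne this]
      simp [wordPreLie, letterMul, ih ζ h', h2]

theorem mixedComp_support_finite (c d : Series 𝕜 m) (ζ : Word m) :
    (Function.support fun η : Word m => phi d η (mono []) ζ • c η).Finite := by
  refine (List.finite_length_le (Fin (m + 1)) ζ.length).subset fun η hη => ?_
  by_contra hlt
  exact hη (by simp [phi_eq_zero_of_length_lt d (mono []) η ζ (by simpa using hlt)])

theorem preLie_support_finite (c d : Series 𝕜 m) (ζ : Word m) :
    (Function.support fun η : Word m => wordPreLie d η ζ • c η).Finite := by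
  refine (List.finite_length_le (Fin (m + 1)) ζ.length).subset fun η hη => ?_
  by_contra hlt
  exact hη (by simp [wordPreLie_eq_zero_of_length_lt d η ζ (by simpa using hlt)])

end Series

/-! ## Locally convergent series and the Silva topology -/

/-- The weight `M ^ |η| |η|!`. -/
def weight {m : ℕ} (M : ℝ) (η : Word m) : ℝ := M ^ η.length * (Nat.factorial η.length : ℝ)

theorem weight_pos {m : ℕ} {M : ℝ} (hM : 0 < M) (η : Word m) : 0 < weight M η := by
  unfold weight
  positivity

theorem weight_mono {m : ℕ} {M N : ℝ} (hM : 0 ≤ M) (h : M ≤ N) (η : Word m) :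
    weight M η ≤ weight N η := by
  unfold weight
  gcongr

section Silva

variable (𝕜 : Type*) [RCLike 𝕜] (m : ℕ)

/-- The space of locally convergent series: `|(c, η)| ≤ K M ^ |η| |η|!` for some `K, M ≥ 0`. -/
def lcSubmodule : Submodule 𝕜 (Series 𝕜 m) where
  carrier := {c | ∃ K M : ℝ, 0 ≤ K ∧ 0 ≤ M ∧ ∀ η, ‖c η‖ ≤ K * weight M η}
  zero_mem' := ⟨0, 0, le_rfl, le_rfl, fun η => by simp⟩
  add_mem' := by
    rintro a b ⟨K, M, hK, hM, ha⟩ ⟨L, N, hL, hN, hb⟩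
    refine ⟨K + L, max M N, by positivity, le_max_of_le_left hM, fun η => ?_⟩
    have h1 : K * weight M η ≤ K * weight (max M N) η :=
      mul_le_mul_of_nonneg_left (weight_mono hM (le_max_left _ _) η) hK
    have h2 : L * weight N η ≤ L * weight (max M N) η :=
      mul_le_mul_of_nonneg_left (weight_mono hN (le_max_right _ _) η) hL
    calc ‖(a + b) η‖ ≤ ‖a η‖ + ‖b η‖ := norm_add_le _ _
      _ ≤ (K + L) * weight (max M N) η := by linarith [ha η, hb η]
  smul_mem' := by
    rintro r a ⟨K, M, hK, hM, ha⟩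
    refine ⟨‖r‖ * K, M, by positivity, hM, fun η => ?_⟩
    calc ‖(r • a) η‖ = ‖r‖ * ‖a η‖ := by rw [Pi.smul_apply, norm_smul]
      _ ≤ ‖r‖ * K * weight M η := by
        rw [mul_assoc]
        exact mul_le_mul_of_nonneg_left (ha η) (norm_nonneg r)

/-- The space of locally convergent series as a type of its own, so that it can carry the Silva
topology rather than the subspace topology of the product topology. -/
def LCSeries : Type _ := lcSubmodule 𝕜 m

namespace LCSeries

instance : AddCommGroup (LCSeries 𝕜 m) := inferInstanceAs (AddCommGroup (lcSubmodule 𝕜 m))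

instance : Module 𝕜 (LCSeries 𝕜 m) := inferInstanceAs (Module 𝕜 (lcSubmodule 𝕜 m))

instance : Module ℝ (LCSeries 𝕜 m) := inferInstanceAs (Module ℝ (lcSubmodule 𝕜 m))

instance : IsScalarTower ℝ 𝕜 (LCSeries 𝕜 m) :=
  inferInstanceAs (IsScalarTower ℝ 𝕜 (lcSubmodule 𝕜 m))

variable {𝕜 m} in
/-- The underlying formal power series. -/
def toSeries (c : LCSeries 𝕜 m) : Series 𝕜 m := Subtype.val c

end LCSeries

/-- The subspace of series for which `|(c, η)| / (M ^ |η| |η|!)` is bounded. -/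
def lInfSubmodule (M : Set.Ioi (0 : ℝ)) : Submodule 𝕜 (Series 𝕜 m) where
  carrier := {c | ∃ K : ℝ, ∀ η, ‖c η‖ / weight M.1 η ≤ K}
  zero_mem' := ⟨0, fun η => by simp⟩
  add_mem' := by
    rintro a b ⟨K, ha⟩ ⟨L, hb⟩
    refine ⟨K + L, fun η => ?_⟩
    calc ‖(a + b) η‖ / weight M.1 η ≤ (‖a η‖ + ‖b η‖) / weight M.1 η :=
          div_le_div_of_nonneg_right (norm_add_le _ _) (weight_pos M.2 η).le
      _ ≤ K + L := by rw [add_div]; exact add_le_add (ha η) (hb η)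
  smul_mem' := by
    rintro r a ⟨K, ha⟩
    refine ⟨‖r‖ * K, fun η => ?_⟩
    calc ‖(r • a) η‖ / weight M.1 η = ‖r‖ * (‖a η‖ / weight M.1 η) := by
          rw [Pi.smul_apply, norm_smul, mul_div_assoc]
      _ ≤ ‖r‖ * K := mul_le_mul_of_nonneg_left (ha η) (norm_nonneg r)

/-- The Banach space `ℓ_{∞, M}` of series. -/
def LInf (M : Set.Ioi (0 : ℝ)) : Type _ := lInfSubmodule 𝕜 m M

namespace LInf

variable (M : Set.Ioi (0 : ℝ))

instance : AddCommGroup (LInf 𝕜 m M) := inferInstanceAs (AddCommGroup (lInfSubmodule 𝕜 m M))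

instance : Module 𝕜 (LInf 𝕜 m M) := inferInstanceAs (Module 𝕜 (lInfSubmodule 𝕜 m M))

/-- Rescaling of the coefficients identifies `ℓ_{∞, M}` with a space of bounded functions. -/
def rescale : LInf 𝕜 m M →ₗ[𝕜] lp (fun _ : Word m => Fin m → 𝕜) ∞ where
  toFun c := ⟨fun η => ((weight M.1 η)⁻¹ : ℝ) • c.1 η, by
    obtain ⟨K, hK⟩ := c.2
    refine memℓp_infty ⟨K, ?_⟩
    rintro _ ⟨η, rfl⟩
    refine le_trans (le_of_eq ?_) (hK η)
    simp only [norm_smul, norm_inv, Real.norm_of_nonneg (weight_pos M.2 η).le, div_eq_inv_mul]⟩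
  map_add' a b := by
    ext η : 2
    exact smul_add _ _ _
  map_smul' r a := by
    ext η : 2
    exact smul_comm ((weight M.1 η)⁻¹ : ℝ) r (a.1 η)

theorem rescale_injective : Function.Injective (rescale 𝕜 m M) := by
  intro a b h
  refine Subtype.ext (funext fun η => ?_)
  have h1 : ((weight M.1 η)⁻¹ : ℝ) • a.1 η = ((weight M.1 η)⁻¹ : ℝ) • b.1 η :=
    congrFun (congrArg Subtype.val h) η
  exact smul_right_injective (Fin m → 𝕜) (inv_ne_zero (weight_pos M.2 η).ne') h1

instance : NormedAddCommGroup (LInf 𝕜 m M) :=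
  NormedAddCommGroup.induced _ _ (rescale 𝕜 m M) (rescale_injective 𝕜 m M)

/-- The norm of `ℓ_{∞, M}` is `sup_η |(c, η)| / (M ^ |η| |η|!)`. -/
theorem norm_eq (c : LInf 𝕜 m M) : ‖c‖ = ⨆ η : Word m, ‖c.1 η‖ / weight M.1 η := by
  change ‖rescale 𝕜 m M c‖ = _
  rw [lp.norm_eq_ciSup]
  refine iSup_congr fun η => ?_
  change ‖((weight M.1 η)⁻¹ : ℝ) • c.1 η‖ = _
  rw [norm_smul, norm_inv, Real.norm_of_nonneg (weight_pos M.2 η).le, div_eq_inv_mul]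

/-- The inclusion of a Banach step into the space of locally convergent series. -/
def incl : LInf 𝕜 m M →ₗ[𝕜] LCSeries 𝕜 m where
  toFun c := ⟨c.1, by
    obtain ⟨K, hK⟩ := c.2
    refine ⟨max K 0, M.1, le_max_right _ _, le_of_lt M.2, fun η => ?_⟩
    have h1 := (div_le_iff₀ (weight_pos M.2 η)).mp (hK η)
    exact h1.trans (mul_le_mul_of_nonneg_right (le_max_left _ _) (weight_pos M.2 η).le)⟩
  map_add' _ _ := rfl
  map_smul' _ _ := rfl

end LInf

namespace LCSeries

/-- The locally convex vector space topologies for which all inclusions of the Banach steps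
are continuous. -/
def admissibleTopologies : Set (TopologicalSpace (LCSeries 𝕜 m)) :=
  {t | @IsTopologicalAddGroup _ t _ ∧ @ContinuousSMul 𝕜 _ _ _ t ∧
    @LocallyConvexSpace ℝ _ _ _ _ _ t ∧
    ∀ M : Set.Ioi (0 : ℝ), @Continuous _ _ _ t (LInf.incl 𝕜 m M)}

/-- The Silva topology: the locally convex inductive limit of the Banach steps, i.e. the finest
locally convex vector space topology for which all inclusions are continuous. -/
instance : TopologicalSpace (LCSeries 𝕜 m) := sInf (admissibleTopologies 𝕜 m)

instance : IsTopologicalAddGroup (LCSeries 𝕜 m) :=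
  topologicalAddGroup_sInf fun _ ht => ht.1

instance : ContinuousSMul 𝕜 (LCSeries 𝕜 m) :=
  continuousSMul_sInf fun _ ht => ht.2.1

instance : LocallyConvexSpace ℝ (LCSeries 𝕜 m) :=
  LocallyConvexSpace.sInf fun _ ht => ht.2.2.1

theorem continuous_incl (M : Set.Ioi (0 : ℝ)) : Continuous (LInf.incl 𝕜 m M) :=
  continuous_sInf_rng.mpr fun _ ht => ht.2.2.2 M

end LCSeries

/-- The set `δ + 𝕜^m_LC⟨⟨X⟩⟩`: the element `⟨c⟩` stands for `δ + c`. -/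
@[ext]
structure UnitalLC where
  /-- The locally convergent series `c` of `δ + c`. -/
  tail : LCSeries 𝕜 m

namespace UnitalLC

/-- The bijection `δ + c ↦ c`. -/
def tailEquiv : UnitalLC 𝕜 m ≃ LCSeries 𝕜 m where
  toFun := tail
  invFun := mk
  left_inv _ := rfl
  right_inv _ := rfl

instance : TopologicalSpace (UnitalLC 𝕜 m) :=
  TopologicalSpace.induced (tailEquiv 𝕜 m) inferInstance

/-- The global chart `δ + c ↦ c`. -/
def tailHomeo : UnitalLC 𝕜 m ≃ₜ LCSeries 𝕜 m := (tailEquiv 𝕜 m).toHomeomorphOfIsInducing ⟨rfl⟩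

/-- The manifold structure of an affine space: its atlas consists of the global chart. -/
instance : ChartedSpace (LCSeries 𝕜 m) (UnitalLC 𝕜 m) :=
  (tailHomeo 𝕜 m).toOpenPartialHomeomorph.singletonChartedSpace rfl

end UnitalLC

end Silva

/-! ## Calculus in locally convex spaces -/

section Calculus

variable (𝕜 : Type*) [RCLike 𝕜]
variable {E F : Type*} [AddCommGroup E] [Module 𝕜 E]
  [AddCommGroup F] [Module 𝕜 F] [TopologicalSpace F]

/-- `f'` is the directional derivative `(D_v f)(x) = lim_{t → 0} t⁻¹ (f (x + t v) - f x)`,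
with `t` in `𝕜`. -/
def HasDirDeriv (f : E → F) (f' : F) (x v : E) : Prop :=
  Tendsto (fun t : 𝕜 => t⁻¹ • (f (x + t • v) - f x)) (𝓝[≠] 0) (𝓝 f')

open Classical in
/-- The directional derivative `(D_v f)(x)`, and `0` if it does not exist. -/
def dirDeriv (f : E → F) (x v : E) : F :=
  if h : ∃ f', HasDirDeriv 𝕜 f f' x v then h.choose else 0

/-- `iterDirDeriv 𝕜 f k x y = (D_{y_k} ⋯ D_{y_1} f)(x)`. -/
def iterDirDeriv (f : E → F) : (k : ℕ) → E → (Fin k → E) → F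
  | 0, x, _ => f x
  | k + 1, x, y =>
      dirDeriv 𝕜 (fun z => iterDirDeriv f k z (Fin.init y)) x (y (Fin.last k))

/-- `f` is a `C^∞` map over `𝕜` on the open set `U`: all iterated directional derivatives exist
on `U` and are jointly continuous on `U × E ^ k`. -/
structure IsSmoothOn [TopologicalSpace E] (f : E → F) (U : Set E) : Prop where
  exists_deriv : ∀ (k : ℕ) (y : Fin k → E) (v : E), ∀ x ∈ U,
    ∃ f', HasDirDeriv 𝕜 (fun z => iterDirDeriv 𝕜 f k z y) f' x v
  continuousOn : ∀ k : ℕ,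
    ContinuousOn (fun p : E × (Fin k → E) => iterDirDeriv 𝕜 f k p.1 p.2) (U ×ˢ Set.univ)

/-- The Lie bracket `[X, Y](x) = dY(x; X(x)) - dX(x; Y(x))` of vector fields on (an open subset
of) a locally convex space. -/
def vectorFieldBracket (X Y : F → F) (x : F) : F :=
  dirDeriv 𝕜 Y x (X x) - dirDeriv 𝕜 X x (Y x)

end Calculus

/-! ## Locally convex Lie groups and their Lie algebras -/

section LieGroups

variable (𝕜 : Type*) [RCLike 𝕜]
variable (E : Type*) [AddCommGroup E] [Module 𝕜 E] [Module ℝ E] [IsScalarTower ℝ 𝕜 E]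
  [TopologicalSpace E]
  [IsTopologicalAddGroup E] [ContinuousSMul 𝕜 E] [LocallyConvexSpace ℝ E]
variable (G : Type*) [Group G] [TopologicalSpace G] [ChartedSpace E G]

/-- `G` is a (Hausdorff) Lie group over `𝕜` modelled on the locally convex space `E`: its charts
are `C^∞`-compatible, and the group operations are continuous and `C^∞` in charts. -/
structure IsLocallyConvexLieGroup : Prop where
  t2 : T2Space G
  topologicalGroup : IsTopologicalGroup G
  smooth_transition : ∀ φ ∈ atlas E G, ∀ ψ ∈ atlas E G,
    IsSmoothOn 𝕜 (fun x => ψ (φ.symm x)) {x | x ∈ φ.target ∧ φ.symm x ∈ ψ.source}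
  smooth_mul : ∀ φ ∈ atlas E G, ∀ ψ ∈ atlas E G, ∀ χ ∈ atlas E G,
    IsSmoothOn 𝕜 (fun p : E × E => χ (φ.symm p.1 * ψ.symm p.2))
      {p | p.1 ∈ φ.target ∧ p.2 ∈ ψ.target ∧ φ.symm p.1 * ψ.symm p.2 ∈ χ.source}
  smooth_inv : ∀ φ ∈ atlas E G, ∀ ψ ∈ atlas E G,
    IsSmoothOn 𝕜 (fun x => ψ (φ.symm x)⁻¹) {x | x ∈ φ.target ∧ (φ.symm x)⁻¹ ∈ ψ.source}

variable {E}

/-- The tangent space `T_1 G` is identified with `E` through the preferred chart `φ` at `1`. The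
left invariant vector field with value `v` at `1`, expressed in the chart `φ`: its value at
`g = φ⁻¹ x` is `T λ_g (v)`, where `λ_g` is the left multiplication with `g`. -/
def leftInvariantField (v : E) (x : E) : E :=
  let φ := chartAt E (1 : G)
  dirDeriv 𝕜 (fun y => φ (φ.symm x * φ.symm y)) (φ 1) v

/-- The bracket of the Lie algebra `T_1 G ≅ E` of `G`: the value at `1` of the Lie bracket of
left invariant vector fields, expressed in the preferred chart at `1`. -/
def lieGroupBracket (v w : E) : E :=
  vectorFieldBracket 𝕜 (leftInvariantField 𝕜 G v) (leftInvariantField 𝕜 G w) (chartAt E (1 : G) 1)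

/-- The Lie algebra axioms for a bracket on a vector space. -/
structure IsLieAlgebraBracket {L : Type*} [AddCommGroup L] [Module 𝕜 L] (b : L → L → L) :
    Prop where
  add_left : ∀ u v w, b (u + v) w = b u w + b v w
  add_right : ∀ u v w, b u (v + w) = b u v + b u w
  smul_left : ∀ (r : 𝕜) (u v), b (r • u) v = r • b u v
  smul_right : ∀ (r : 𝕜) (u v), b u (r • v) = r • b u v
  self : ∀ u, b u u = 0
  jacobi : ∀ u v w, b u (b v w) + b v (b w u) + b w (b u v) = 0

end LieGroups

end

/-! The proof has an algebraic half, on all formal series, and an analytic half.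

Algebra. Everything is done one first letter at a time. The left shift `lshift x` is a derivation of
the shuffle product (`shuffle_cons`), and the scalar composition `comp d` satisfies a recursion in
which `d` occurs only behind a letter `x_0` (`comp_cons`). Comparing recursions shows that `comp d`
is multiplicative for the shuffle (`comp_shuffle`) and that compositions compose (`comp_comp`),
which is associativity. Since `d` enters only through strictly shorter words (`comp_congr`), the
equation `d = -(c ∘ d)` is solved length by length, which gives right inverses. Linearising the
recursion in `d` at `0` gives the pre-Lie action `pre` (`hasDerivAt_comp`). It acts by derivations
of the shuffle, its associator is symmetric, and so the commutator satisfies the Jacobi identity.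

Estimates. `norm_comp_le` bounds compositions with factorial growth. A weight `1 / (n + 1) ^ 2`
makes the convolutions coming from shuffles cost only a constant factor, so product and inverse map
bounded sets into bounded sets.

Topology. The sets `boundedSet n` are compact, they exhaust the Silva space, and on each of them
convergence is coefficientwise. Every neighbourhood condition on the space can be tested on them
(`mem_nhds_zero`), so a map is continuous as soon as its restrictions to these sets are; this
survives finite products.

Smoothness. Each coefficient of the product or the inverse is a polynomial in finitely many
coefficients of the arguments. Replacing its scalars by their norms gives a majorant `q`, whose
derivative is controlled by `q (w + w) - q w` regardless of the degree. Hence all iterated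
derivatives again have polynomial coefficients with majorants bounded on bounded sets, and all of
them exist and are continuous. The majorants themselves are the same operations over `ℝ`, so the
estimates already proved bound them.

In the global chart the left invariant field with value `v` is `x ↦ v + x ◁ v`. It is affine in `x`,
which gives the bracket at once. -/

noncomputable section

set_option linter.unusedSectionVars false

namespace Series

/-! ### The shuffle algebra and the group law on formal series. -/

section Algebra

variable {𝕜 : Type*} [RCLike 𝕜] {m : ℕ}

/-- The left shift `x_i⁻¹ e` of a series. -/
def lshift (i : Fin (m + 1)) (e : ScalarSeries 𝕜 m) : ScalarSeries 𝕜 m := fun ζ => e (i :: ζ)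

@[simp] theorem lshift_apply (i : Fin (m + 1)) (e : ScalarSeries 𝕜 m) (ζ : Word m) :
    lshift i e ζ = e (i :: ζ) := rfl

@[simp] theorem lshift_add (i : Fin (m + 1)) (a b : ScalarSeries 𝕜 m) :
    lshift i (a + b) = lshift i a + lshift i b := rfl

@[simp] theorem lshift_smul (i : Fin (m + 1)) (r : 𝕜) (a : ScalarSeries 𝕜 m) :
    lshift i (r • a) = r • lshift i a := rfl

/-- The first letter of a shuffle is the first letter of one of the two words. The form with `head?`
and `tail` covers empty words too, where the definition of `shuffleWords` has separate clauses. -/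
theorem count_cons_shuffleWords {α : Type*} [DecidableEq α] (x : α) (ζ η ξ : List α) :
    (shuffleWords η ξ).count (x :: ζ) =
      (if η.head? = some x then (shuffleWords η.tail ξ).count ζ else 0) +
      (if ξ.head? = some x then (shuffleWords η ξ.tail).count ζ else 0) := by
  have key : ∀ (y : α) (s : Multiset (List α)),
      (s.map (List.cons y)).count (x :: ζ) = if y = x then s.count ζ else 0 := by
    intro y s
    split_ifs with h
    · subst h
      exact Multiset.count_map_eq_count' _ _ (List.cons_injective) _
    · refine Multiset.count_eq_zero_of_notMem fun hmem => ?_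
      obtain ⟨a, -, ha⟩ := Multiset.mem_map.mp hmem
      exact h (List.cons.inj ha).1
  cases η with
  | nil =>
    cases ξ with
    | nil => simp [shuffleWords]
    | cons y ξ =>
      simp only [shuffleWords, Multiset.count_singleton, List.head?_cons, List.head?_nil,
        List.tail_cons, List.cons.injEq, Option.some.injEq, reduceCtorEq, if_false, zero_add]
      by_cases h : y = x
      · subst h; simp
      · simp [h, Ne.symm h]
  | cons a η =>
    cases ξ with
    | nil =>
      have h0 : ∀ η : List α, shuffleWords η [] = {η} := by
        intro η; cases η <;> simp [shuffleWords]
      simp only [h0, Multiset.count_singleton, List.head?_cons, List.head?_nil,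
        List.tail_cons, List.cons.injEq, Option.some.injEq, reduceCtorEq, if_false, add_zero]
      by_cases h : a = x
      · subst h; simp
      · simp [h, Ne.symm h]
    | cons y ξ =>
      rw [shuffleWords, Multiset.count_add, key, key]
      simp

theorem shuffle_nil (c d : ScalarSeries 𝕜 m) : shuffle c d [] = c [] * d [] := by
  classical
  unfold shuffle
  rw [finsum_eq_single _ (([], []) : Word m × Word m)]
  · simp [shuffleWords]
  · rintro ⟨η, ξ⟩ h
    rw [Multiset.count_eq_zero_of_notMem, Nat.cast_zero, mul_zero]
    intro hmem
    have := length_of_mem_shuffleWords _ _ _ hmem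
    simp only [List.length_nil] at this
    exact h (Prod.ext (List.length_eq_zero_iff.mp (by simp only; omega))
      (List.length_eq_zero_iff.mp (by simp only; omega)))

/-- The left shift is a derivation of the shuffle product. With `shuffle_nil` this determines the
product, and all later facts about it follow by induction from these two. -/
theorem shuffle_cons (c d : ScalarSeries 𝕜 m) (x : Fin (m + 1)) (ζ : Word m) :
    shuffle c d (x :: ζ) = shuffle (lshift x c) d ζ + shuffle c (lshift x d) ζ := by
  classical
  have hl : shuffle (lshift x c) d ζ = ∑ᶠ p : Word m × Word m, c p.1 * d p.2 *
      ((if p.1.head? = some x then (shuffleWords p.1.tail p.2).count ζ else 0 : ℕ) : 𝕜) := by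
    have hg : Function.Injective fun p : Word m × Word m => ((x :: p.1, p.2) : Word m × Word m) := by
      rintro ⟨a, b⟩ ⟨a', b'⟩ h
      simpa using h
    -- Only pairs whose first word begins with `x` contribute, so the sum is restricted to the range
    -- of `p ↦ (x :: p.1, p.2)` and reindexed.
    rw [shuffle, ← finsum_mem_univ (f := fun p : Word m × Word m => c p.1 * d p.2 * _),
      ← finsum_mem_inter_support, Set.univ_inter,
      ← Set.inter_eq_self_of_subset_right (s := Set.range fun p : Word m × Word m =>
        ((x :: p.1, p.2) : Word m × Word m)) (t := Function.support _),
      finsum_mem_inter_support, finsum_mem_range hg]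
    · refine finsum_congr fun p => ?_
      simp
    · rintro ⟨a, b⟩ hp
      cases a with
      | nil => simp at hp
      | cons y a =>
        by_cases h : y = x
        · subst h; exact ⟨(a, b), rfl⟩
        · simp [h] at hp
  have hr : shuffle c (lshift x d) ζ = ∑ᶠ p : Word m × Word m, c p.1 * d p.2 *
      ((if p.2.head? = some x then (shuffleWords p.1 p.2.tail).count ζ else 0 : ℕ) : 𝕜) := by
    have hg : Function.Injective fun p : Word m × Word m => ((p.1, x :: p.2) : Word m × Word m) := by
      rintro ⟨a, b⟩ ⟨a', b'⟩ h
      simpa using h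
    rw [shuffle, ← finsum_mem_univ (f := fun p : Word m × Word m => c p.1 * d p.2 * _),
      ← finsum_mem_inter_support, Set.univ_inter,
      ← Set.inter_eq_self_of_subset_right (s := Set.range fun p : Word m × Word m =>
        ((p.1, x :: p.2) : Word m × Word m)) (t := Function.support _),
      finsum_mem_inter_support, finsum_mem_range hg]
    · refine finsum_congr fun p => ?_
      simp
    · rintro ⟨a, b⟩ hp
      cases b with
      | nil => simp at hp
      | cons y b =>
        by_cases h : y = x
        · subst h; exact ⟨(a, b), rfl⟩
        · simp [h] at hp
  -- Splitting a `finsum` of a sum requires both supports to be finite.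
  have fin : ∀ g : Word m × Word m → ℕ,
      (∀ p, g p ≤ (shuffleWords p.1 p.2).count (x :: ζ)) →
      (Function.support fun p : Word m × Word m => c p.1 * d p.2 * (g p : 𝕜)).Finite := by
    intro g hg
    refine ((List.finite_length_le (Fin (m + 1)) (x :: ζ).length).prod
      (List.finite_length_le (Fin (m + 1)) (x :: ζ).length)).subset fun p hp => ?_
    have h0 : g p ≠ 0 := by
      intro h; exact hp (by simp [h])
    have hl := length_of_mem_shuffleWords p.1 p.2 (x :: ζ)
      (Multiset.count_pos.mp (lt_of_lt_of_le (Nat.pos_of_ne_zero h0) (hg p)))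
    simp only [Set.mem_prod, Set.mem_ofPred_eq]
    omega
  rw [hl, hr, ← finsum_add_distrib, shuffle]
  · refine finsum_congr fun p => ?_
    rw [count_cons_shuffleWords, Nat.cast_add, mul_add]
  · exact fin _ fun p => by rw [count_cons_shuffleWords]; exact Nat.le_add_right _ _
  · exact fin _ fun p => by rw [count_cons_shuffleWords]; exact Nat.le_add_left _ _

theorem lshift_shuffle (x : Fin (m + 1)) (c d : ScalarSeries 𝕜 m) :
    lshift x (shuffle c d) = shuffle (lshift x c) d + shuffle c (lshift x d) :=
  funext fun ζ => shuffle_cons c d x ζ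

theorem shuffle_comm (a b : ScalarSeries 𝕜 m) : shuffle a b = shuffle b a := by
  funext ζ
  induction ζ generalizing a b with
  | nil => rw [shuffle_nil, shuffle_nil, mul_comm]
  | cons x ζ ih => rw [shuffle_cons, shuffle_cons, ih, ih a, add_comm]

theorem shuffle_add (a b c : ScalarSeries 𝕜 m) :
    shuffle a (b + c) = shuffle a b + shuffle a c := by
  funext ζ
  induction ζ generalizing a b c with
  | nil => simp only [shuffle_nil, Pi.add_apply, mul_add]
  | cons x ζ ih =>
    simp only [shuffle_cons, Pi.add_apply, lshift_add, ih]
    ring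

theorem add_shuffle (a b c : ScalarSeries 𝕜 m) :
    shuffle (a + b) c = shuffle a c + shuffle b c := by
  rw [shuffle_comm, shuffle_add, shuffle_comm c, shuffle_comm c]

theorem shuffle_smul (r : 𝕜) (a b : ScalarSeries 𝕜 m) :
    shuffle a (r • b) = r • shuffle a b := by
  funext ζ
  induction ζ generalizing a b with
  | nil => simp only [shuffle_nil, Pi.smul_apply, smul_eq_mul]; ring
  | cons x ζ ih =>
    simp only [shuffle_cons, Pi.smul_apply, lshift_smul, ih, smul_add]

theorem smul_shuffle (r : 𝕜) (a b : ScalarSeries 𝕜 m) :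
    shuffle (r • a) b = r • shuffle a b := by
  rw [shuffle_comm, shuffle_smul, shuffle_comm]

@[simp] theorem shuffle_zero (a : ScalarSeries 𝕜 m) : shuffle a 0 = 0 := by
  simpa using shuffle_smul 0 a 0

@[simp] theorem zero_shuffle (a : ScalarSeries 𝕜 m) : shuffle 0 a = 0 := by
  rw [shuffle_comm, shuffle_zero]

theorem shuffle_sum {ι : Type*} (s : Finset ι) (a : ScalarSeries 𝕜 m)
    (b : ι → ScalarSeries 𝕜 m) : shuffle a (∑ i ∈ s, b i) = ∑ i ∈ s, shuffle a (b i) := by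
  classical
  induction s using Finset.induction_on with
  | empty => simp
  | insert i s hi ih => rw [Finset.sum_insert hi, Finset.sum_insert hi, shuffle_add, ih]

theorem sum_shuffle {ι : Type*} (s : Finset ι) (a : ScalarSeries 𝕜 m)
    (b : ι → ScalarSeries 𝕜 m) : shuffle (∑ i ∈ s, b i) a = ∑ i ∈ s, shuffle (b i) a := by
  rw [shuffle_comm, shuffle_sum]
  exact Finset.sum_congr rfl fun i _ => shuffle_comm _ _

theorem shuffle_assoc (a b c : ScalarSeries 𝕜 m) :
    shuffle (shuffle a b) c = shuffle a (shuffle b c) := by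
  funext ζ
  induction ζ generalizing a b c with
  | nil => simp only [shuffle_nil, mul_assoc]
  | cons x ζ ih =>
    simp only [shuffle_cons, lshift_shuffle, add_shuffle, shuffle_add, Pi.add_apply, ih]
    ring

theorem shuffle_left_comm (a b c : ScalarSeries 𝕜 m) :
    shuffle a (shuffle b c) = shuffle b (shuffle a c) := by
  rw [← shuffle_assoc, shuffle_comm a b, shuffle_assoc]

/-- A coefficient of a shuffle sees only words that are no longer. This allows an induction
hypothesis known up to a given length to be used inside a shuffle. -/
theorem shuffle_congr {a a' b b' : ScalarSeries 𝕜 m} {ζ : Word m}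
    (ha : ∀ ξ : Word m, ξ.length ≤ ζ.length → a ξ = a' ξ)
    (hb : ∀ ξ : Word m, ξ.length ≤ ζ.length → b ξ = b' ξ) :
    shuffle a b ζ = shuffle a' b' ζ := by
  induction ζ generalizing a b a' b' with
  | nil => rw [shuffle_nil, shuffle_nil, ha [] le_rfl, hb [] le_rfl]
  | cons x ζ ih =>
    rw [shuffle_cons, shuffle_cons]
    have h : ∀ ξ : Word m, ξ.length ≤ ζ.length → ξ.length ≤ (x :: ζ).length := fun ξ h => by
      simp only [List.length_cons]; omega
    have h' : ∀ ξ : Word m, ξ.length ≤ ζ.length → (x :: ξ).length ≤ (x :: ζ).length :=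
      fun ξ h => by simpa using h
    rw [ih (a := lshift x a) (b := b) (a' := lshift x a') (b' := b')
        (fun ξ hξ => ha _ (h' ξ hξ)) fun ξ hξ => hb _ (h ξ hξ),
      ih (a := a) (b := lshift x b) (a' := a') (b' := lshift x b')
        (fun ξ hξ => ha _ (h ξ hξ)) fun ξ hξ => hb _ (h' ξ hξ)]

/-! ### Sums over words -/

/-- The words of length at most `N`. -/
def wordsLe (m N : ℕ) : Finset (Word m) := (List.finite_length_le (Fin (m + 1)) N).toFinset

theorem mem_wordsLe {N : ℕ} {η : Word m} : η ∈ wordsLe m N ↔ η.length ≤ N := by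
  simp [wordsLe]

theorem sum_wordsLe_succ {M : Type*} [AddCommMonoid M] (N : ℕ) (f : Word m → M) :
    ∑ η ∈ wordsLe m (N + 1), f η = f [] + ∑ i, ∑ η ∈ wordsLe m N, f (i :: η) := by
  classical
  have h : wordsLe m (N + 1) = insert []
      ((Finset.univ ×ˢ wordsLe m N).image fun p : Fin (m + 1) × Word m => p.1 :: p.2) := by
    ext η
    cases η with
    | nil => simp [mem_wordsLe]
    | cons i η => simp [mem_wordsLe]
  rw [h, Finset.sum_insert (by simp), Finset.sum_image, Finset.sum_product]
  rintro ⟨i, η⟩ - ⟨j, ξ⟩ - h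
  simpa using h

theorem finsum_word_eq_sum {M : Type*} [AddCommMonoid M] {N : ℕ} {f : Word m → M}
    (h : ∀ η, N < η.length → f η = 0) : ∑ᶠ η, f η = ∑ η ∈ wordsLe m N, f η := by
  refine finsum_eq_sum_of_support_subset _ fun η hη => ?_
  by_contra hlt
  exact hη (h η (by simpa [mem_wordsLe] using hlt))

/-! ### The composition of scalar series -/

@[simp] theorem component_zero (d : Series 𝕜 m) : component d 0 = 0 := rfl

@[simp] theorem component_succ (d : Series 𝕜 m) (j : Fin m) (ζ : Word m) :
    component d j.succ ζ = d ζ j := rfl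

theorem component_add (c d : Series 𝕜 m) (i : Fin (m + 1)) :
    component (c + d) i = component c i + component d i := by
  refine Fin.cases ?_ (fun j => ?_) i
  · simp
  · rfl

theorem component_smul (r : 𝕜) (d : Series 𝕜 m) (i : Fin (m + 1)) :
    component (r • d) i = r • component d i := by
  refine Fin.cases ?_ (fun j => ?_) i
  · simp
  · rfl

theorem component_congr {d d' : Series 𝕜 m} {ζ : Word m} (h : d ζ = d' ζ) (i : Fin (m + 1)) :
    component d i ζ = component d' i ζ := by
  simp only [component, h]

/-- The scalar composition `∑ η, (e, η) φ_d(η)(1)`. -/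
def comp (d : Series 𝕜 m) (e : ScalarSeries 𝕜 m) : ScalarSeries 𝕜 m := fun ζ =>
  ∑ᶠ η : Word m, phi d η (mono []) ζ * e η

theorem comp_eq_sum (d : Series 𝕜 m) (e : ScalarSeries 𝕜 m) {N : ℕ} {ζ : Word m}
    (h : ζ.length ≤ N) : comp d e ζ = ∑ η ∈ wordsLe m N, phi d η (mono []) ζ * e η :=
  finsum_word_eq_sum fun η hη => by
    rw [phi_eq_zero_of_length_lt _ _ _ _ (h.trans_lt hη), zero_mul]

theorem comp_nil (d : Series 𝕜 m) (e : ScalarSeries 𝕜 m) : comp d e [] = e [] := by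
  rw [comp, finsum_eq_single _ []]
  · simp [phi, mono]
  · intro η hη
    rw [phi_eq_zero_of_length_lt _ _ _ _ (by simpa [List.length_pos_iff] using hη), zero_mul]

/-- The letter `x_i` acts by `e ↦ x_i e + x_0 (d[i] ⧢ e)`, so a word starting with `x` arises from
`x` itself, or, if `x = x_0`, from any letter `x_i`. This recursion replaces the definition from
here on. -/
theorem comp_cons (d : Series 𝕜 m) (e : ScalarSeries 𝕜 m) (x : Fin (m + 1)) (ζ : Word m) :
    comp d e (x :: ζ) = comp d (lshift x e) ζ +
      if x = 0 then ∑ i, shuffle (component d i) (comp d (lshift i e)) ζ else 0 := by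
  rw [comp_eq_sum d e (N := ζ.length + 1) (by simp), sum_wordsLe_succ]
  have h0 : phi d [] (mono []) (x :: ζ) = (0 : 𝕜) := by simp [phi, mono]
  have h1 : ∀ i (η : Word m), phi d (i :: η) (mono []) (x :: ζ) * e (i :: η) =
      (if x = i then phi d η (mono []) ζ * e (i :: η) else 0) +
      if x = 0 then shuffle (component d i) (e (i :: η) • phi d η (mono [])) ζ else 0 := by
    intro i η
    rw [shuffle_smul]
    simp only [phi, letterMul, Pi.add_apply, Pi.smul_apply, smul_eq_mul]
    split_ifs <;> ring
  simp only [h0, zero_mul, zero_add, h1, Finset.sum_add_distrib]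
  congr 1
  · rw [Finset.sum_comm, comp_eq_sum d _ le_rfl]
    refine Finset.sum_congr rfl fun η _ => ?_
    simp
  · split_ifs with hx
    · refine Finset.sum_congr rfl fun i _ => ?_
      have h2 : ∀ s : Finset (Word m), ∀ f : Word m → ScalarSeries 𝕜 m,
          ∑ η ∈ s, f η ζ = (∑ η ∈ s, f η) ζ := fun s f => by simp
      rw [h2, ← shuffle_sum]
      -- The sum over words of length at most `ζ.length` agrees with `comp` only up to that length,
      -- which is all the shuffle at `ζ` sees.
      refine shuffle_congr (fun _ _ => rfl) fun ξ hξ => ?_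
      rw [comp_eq_sum d _ hξ]
      simp [mul_comm]
    · simp

theorem lshift_comp (d : Series 𝕜 m) (e : ScalarSeries 𝕜 m) (x : Fin (m + 1)) :
    lshift x (comp d e) = comp d (lshift x e) +
      if x = 0 then ∑ i, shuffle (component d i) (comp d (lshift i e)) else 0 := by
  funext ζ
  rw [lshift_apply, comp_cons, Pi.add_apply]
  split_ifs <;> simp

theorem comp_add (d : Series 𝕜 m) (a b : ScalarSeries 𝕜 m) :
    comp d (a + b) = comp d a + comp d b := by
  funext ζ
  simp only [comp_eq_sum d _ (le_refl ζ.length), Pi.add_apply, mul_add, Finset.sum_add_distrib]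

theorem comp_smul (d : Series 𝕜 m) (r : 𝕜) (a : ScalarSeries 𝕜 m) :
    comp d (r • a) = r • comp d a := by
  funext ζ
  simp only [comp_eq_sum d _ (le_refl ζ.length), Pi.smul_apply, smul_eq_mul, Finset.mul_sum]
  exact Finset.sum_congr rfl fun η _ => by ring

theorem comp_zero (d : Series 𝕜 m) : comp d (0 : ScalarSeries 𝕜 m) = 0 := by
  simpa using comp_smul d 0 0

theorem comp_sum {ι : Type*} (s : Finset ι) (d : Series 𝕜 m) (b : ι → ScalarSeries 𝕜 m) :
    comp d (∑ i ∈ s, b i) = ∑ i ∈ s, comp d (b i) := by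
  classical
  induction s using Finset.induction_on with
  | empty => simp [comp_zero]
  | insert i s hi ih => rw [Finset.sum_insert hi, Finset.sum_insert hi, comp_add, ih]

theorem mixedComp_apply (c d : Series 𝕜 m) (ζ : Word m) (j : Fin m) :
    mixedComp c d ζ j = comp d (component c j.succ) ζ := by
  rw [mixedComp, finsum_word_eq_sum (N := ζ.length), comp_eq_sum d _ le_rfl, Finset.sum_apply]
  · rfl
  · intro η hη
    rw [phi_eq_zero_of_length_lt _ _ _ _ hη, zero_smul]

theorem component_mixedComp (c d : Series 𝕜 m) (i : Fin (m + 1)) :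
    component (mixedComp c d) i = comp d (component c i) := by
  refine Fin.cases ?_ (fun j => ?_) i
  · simp [comp_zero]
  · funext ζ
    rw [component_succ, mixedComp_apply]

theorem ext_component {c d : Series 𝕜 m} (h : ∀ i, component c i = component d i) : c = d := by
  funext ζ j
  exact congrFun (h j.succ) ζ

/-- Composition with `δ + d` is multiplicative for the shuffle product. -/
theorem comp_shuffle (d : Series 𝕜 m) (a b : ScalarSeries 𝕜 m) :
    comp d (shuffle a b) = shuffle (comp d a) (comp d b) := by
  -- The induction runs over lengths because the shuffles in the recursion evaluate at all words up
  -- to that length, not only at the tail.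
  suffices H : ∀ n, ∀ ζ : Word m, ζ.length ≤ n → ∀ a b : ScalarSeries 𝕜 m,
      comp d (shuffle a b) ζ = shuffle (comp d a) (comp d b) ζ from
    funext fun ζ => H _ ζ le_rfl a b
  intro n
  induction n with
  | zero =>
    intro ζ hζ a b
    obtain rfl := List.length_eq_zero_iff.mp (Nat.le_zero.mp hζ)
    simp only [comp_nil, shuffle_nil]
  | succ n ih =>
    rintro (_ | ⟨x, ζ⟩) hζ a b
    · simp only [comp_nil, shuffle_nil]
    have hn : ζ.length ≤ n := by simpa using hζ
    have h1 : ∀ i, shuffle (component d i) (comp d (lshift i (shuffle a b))) ζ =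
        shuffle (shuffle (component d i) (comp d (lshift i a))) (comp d b) ζ +
        shuffle (comp d a) (shuffle (component d i) (comp d (lshift i b))) ζ := by
      intro i
      rw [shuffle_assoc, shuffle_left_comm (comp d a), ← Pi.add_apply, ← shuffle_add]
      refine shuffle_congr (fun _ _ => rfl) fun ξ hξ => ?_
      rw [lshift_shuffle, comp_add, Pi.add_apply, Pi.add_apply, ih _ (hξ.trans hn),
        ih _ (hξ.trans hn)]
    rw [comp_cons, shuffle_cons, lshift_shuffle, comp_add, Pi.add_apply, ih _ hn, ih _ hn,
      lshift_comp, lshift_comp, add_shuffle, shuffle_add, Pi.add_apply, Pi.add_apply]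
    split_ifs with hx
    · simp only [h1, sum_shuffle, shuffle_sum, Finset.sum_apply, Finset.sum_add_distrib]
      ring
    · simp

theorem groupProd_eq (c d : Series 𝕜 m) : groupProd c d = d + mixedComp c d := rfl

theorem component_groupProd (c d : Series 𝕜 m) (i : Fin (m + 1)) :
    component (groupProd c d) i = component d i + comp d (component c i) := by
  rw [groupProd_eq, component_add, component_mixedComp]

/-- In the two recursions the `x_0` terms on the left carry `d[i] ∘ e`, obtained from
`comp_shuffle`, and `e[i]`. Their sum is the component of the group product. -/
theorem comp_comp (d e : Series 𝕜 m) (a : ScalarSeries 𝕜 m) :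
    comp e (comp d a) = comp (groupProd d e) a := by
  suffices H : ∀ n, ∀ ζ : Word m, ζ.length ≤ n → ∀ a : ScalarSeries 𝕜 m,
      comp e (comp d a) ζ = comp (groupProd d e) a ζ from
    funext fun ζ => H _ ζ le_rfl a
  intro n
  induction n with
  | zero =>
    intro ζ hζ a
    obtain rfl := List.length_eq_zero_iff.mp (Nat.le_zero.mp hζ)
    simp only [comp_nil]
  | succ n ih =>
    rintro (_ | ⟨x, ζ⟩) hζ a
    · simp only [comp_nil]
    have hn : ζ.length ≤ n := by simpa using hζ
    -- For `i ≠ 0` the shift of `comp d a` has no correction term, and for `i = 0` the factor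
    -- `component e 0` vanishes.
    have h0 : ∀ i : Fin (m + 1), shuffle (component e i) (comp e (lshift i (comp d a))) =
        shuffle (component e i) (comp e (comp d (lshift i a))) := by
      intro i
      refine Fin.cases ?_ (fun j => ?_) i
      · simp
      · rw [lshift_comp]
        simp
    have h1 : ∀ i, shuffle (component (groupProd d e) i)
          (comp (groupProd d e) (lshift i a)) ζ =
        shuffle (comp e (component d i)) (comp e (comp d (lshift i a))) ζ +
        shuffle (component e i) (comp e (comp d (lshift i a))) ζ := by
      intro i
      rw [component_groupProd, add_comm, ← Pi.add_apply, ← add_shuffle]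
      exact shuffle_congr (fun _ _ => rfl) fun ξ hξ => (ih _ (hξ.trans hn) _).symm
    rw [comp_cons, comp_cons, lshift_comp, comp_add, Pi.add_apply, ih _ hn]
    simp only [h0, h1]
    split_ifs with hx
    · simp only [comp_sum, comp_shuffle, Finset.sum_apply, Finset.sum_add_distrib, add_assoc]
    · simp [comp_zero]

theorem groupProd_assoc (a b c : Series 𝕜 m) :
    groupProd (groupProd a b) c = groupProd a (groupProd b c) := by
  refine ext_component fun i => ?_
  simp only [component_groupProd, comp_add, comp_comp, add_assoc]

@[simp] theorem component_zero_left (i : Fin (m + 1)) : component (0 : Series 𝕜 m) i = 0 := by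
  simpa using component_smul 0 (0 : Series 𝕜 m) i

theorem comp_zero_left (e : ScalarSeries 𝕜 m) : comp (0 : Series 𝕜 m) e = e := by
  funext ζ
  induction ζ generalizing e with
  | nil => exact comp_nil _ e
  | cons x ζ ih => rw [comp_cons, ih]; simp

theorem groupProd_zero (c : Series 𝕜 m) : groupProd c 0 = c := by
  refine ext_component fun i => ?_
  rw [component_groupProd, comp_zero_left, component_zero_left, zero_add]

/-- Every occurrence of `d` stands behind a letter `x_0`, hence the strict inequality in the
hypothesis. This gap makes fixed point equations for `d` solvable. -/
theorem comp_congr {d d' : Series 𝕜 m} {n : ℕ}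
    (h : ∀ ξ : Word m, ξ.length < n → d ξ = d' ξ) :
    ∀ ζ : Word m, ζ.length ≤ n → ∀ e : ScalarSeries 𝕜 m, comp d e ζ = comp d' e ζ := by
  induction n with
  | zero =>
    intro ζ hζ e
    obtain rfl := List.length_eq_zero_iff.mp (Nat.le_zero.mp hζ)
    simp only [comp_nil]
  | succ n ih =>
    have ih' := ih fun ξ hξ => h ξ (by omega)
    rintro (_ | ⟨x, ζ⟩) hζ e
    · simp only [comp_nil]
    have hn : ζ.length ≤ n := by simpa using hζ
    rw [comp_cons, comp_cons, ih' ζ hn]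
    congr 2
    refine Finset.sum_congr rfl fun i _ => shuffle_congr (fun ξ hξ => ?_) fun ξ hξ => ?_
    · exact component_congr (h ξ (by omega)) i
    · exact ih' ξ (by omega) _

/-! ### Inverses -/

/-- Iterates converging to the solution `d` of `d = s • mixedComp c d`. -/
def fixIter (s : 𝕜) (c : Series 𝕜 m) : ℕ → Series 𝕜 m
  | 0 => 0
  | n + 1 => s • mixedComp c (fixIter s c n)

/-- The solution `d` of `d = s • mixedComp c d`. -/
def fixSeries (s : 𝕜) (c : Series 𝕜 m) : Series 𝕜 m := fun ζ => fixIter s c (ζ.length + 1) ζ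

theorem fixIter_stable (s : 𝕜) (c : Series 𝕜 m) (n : ℕ) :
    ∀ ζ : Word m, ζ.length < n → fixIter s c n ζ = fixIter s c (n + 1) ζ := by
  induction n with
  | zero => intro ζ h; omega
  | succ n ih =>
    intro ζ h
    funext j
    rw [fixIter, fixIter, Pi.smul_apply, Pi.smul_apply, Pi.smul_apply, Pi.smul_apply,
      mixedComp_apply, mixedComp_apply, comp_congr ih ζ (by omega)]

theorem fixIter_eq (s : 𝕜) (c : Series 𝕜 m) {n : ℕ} {ζ : Word m} (h : ζ.length < n) :
    fixIter s c n ζ = fixSeries s c ζ := by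
  induction n with
  | zero => omega
  | succ n ih =>
    rcases Nat.lt_succ_iff_lt_or_eq.mp h with h' | h'
    · rw [← fixIter_stable s c n ζ h', ih h']
    · subst h'; rfl

theorem fixSeries_apply (s : 𝕜) (c : Series 𝕜 m) (ζ : Word m) (j : Fin m) :
    fixSeries s c ζ j = s * comp (fixSeries s c) (component c j.succ) ζ := by
  rw [fixSeries, fixIter, Pi.smul_apply, Pi.smul_apply, mixedComp_apply, smul_eq_mul,
    comp_congr (fun ξ hξ => fixIter_eq s c hξ) ζ le_rfl]

/-- The equation for a right inverse is the fixed point equation with `s = -1`. General `s` is kept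
because the majorant of the inversion is the real fixed point with `‖s‖` in place of `s`. -/
theorem groupProd_fixSeries (c : Series 𝕜 m) : groupProd c (fixSeries (-1) c) = 0 := by
  funext ζ j
  rw [groupProd_eq, Pi.add_apply, Pi.add_apply, mixedComp_apply, fixSeries_apply]
  simp

end Algebra

end Series

namespace Series

/-! ### The pre-Lie action and the linearised composition. -/

section PreLie

variable {𝕜 : Type*} [RCLike 𝕜] {m : ℕ}

/-- The scalar pre-Lie action `∑ η, (e, η) (η ◁ v)`. -/
def pre (v : Series 𝕜 m) (e : ScalarSeries 𝕜 m) : ScalarSeries 𝕜 m := fun ζ =>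
  ∑ᶠ η : Word m, wordPreLie v η ζ * e η

theorem pre_eq_sum (v : Series 𝕜 m) (e : ScalarSeries 𝕜 m) {N : ℕ} {ζ : Word m}
    (h : ζ.length ≤ N) : pre v e ζ = ∑ η ∈ wordsLe m N, wordPreLie v η ζ * e η :=
  finsum_word_eq_sum fun η hη => by
    rw [wordPreLie_eq_zero_of_length_lt _ _ _ (h.trans_lt hη), zero_mul]

theorem pre_nil (v : Series 𝕜 m) (e : ScalarSeries 𝕜 m) : pre v e [] = 0 := by
  refine finsum_eq_zero_of_forall_eq_zero fun η => ?_
  cases η <;> simp [wordPreLie, letterMul]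

/-- This is `comp_cons` to first order in the inner series: in the `x_0` terms the composition is
replaced by the identity. -/
theorem pre_cons (v : Series 𝕜 m) (e : ScalarSeries 𝕜 m) (x : Fin (m + 1)) (ζ : Word m) :
    pre v e (x :: ζ) = pre v (lshift x e) ζ +
      if x = 0 then ∑ i, shuffle (component v i) (lshift i e) ζ else 0 := by
  rw [pre_eq_sum v e (N := ζ.length + 1) (by simp), sum_wordsLe_succ]
  have h1 : ∀ i (η : Word m), wordPreLie v (i :: η) (x :: ζ) * e (i :: η) =
      (if x = i then wordPreLie v η ζ * e (i :: η) else 0) +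
      if x = 0 then shuffle (component v i) (e (i :: η) • mono η) ζ else 0 := by
    intro i η
    rw [shuffle_smul, shuffle_comm]
    simp only [wordPreLie, letterMul, Pi.add_apply, Pi.smul_apply, smul_eq_mul]
    split_ifs <;> ring
  have h0 : wordPreLie v [] (x :: ζ) = 0 := rfl
  simp only [h0, zero_mul, zero_add, h1, Finset.sum_add_distrib]
  congr 1
  · rw [Finset.sum_comm, pre_eq_sum v _ le_rfl]
    refine Finset.sum_congr rfl fun η _ => ?_
    simp
  · split_ifs with hx
    · refine Finset.sum_congr rfl fun i _ => ?_
      rw [← Finset.sum_apply ζ (wordsLe m ζ.length) fun η =>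
        shuffle (component v i) (e (i :: η) • mono η), ← shuffle_sum]
      refine shuffle_congr (fun _ _ => rfl) fun ξ hξ => ?_
      simp [mono, Pi.single_apply, mem_wordsLe, hξ]
    · simp

theorem lshift_pre (v : Series 𝕜 m) (e : ScalarSeries 𝕜 m) (x : Fin (m + 1)) :
    lshift x (pre v e) = pre v (lshift x e) +
      if x = 0 then ∑ i, shuffle (component v i) (lshift i e) else 0 := by
  funext ζ
  rw [lshift_apply, pre_cons, Pi.add_apply]
  split_ifs <;> simp

theorem pre_add (v : Series 𝕜 m) (a b : ScalarSeries 𝕜 m) :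
    pre v (a + b) = pre v a + pre v b := by
  funext ζ
  simp only [pre_eq_sum v _ (le_refl ζ.length), Pi.add_apply, mul_add, Finset.sum_add_distrib]

theorem pre_smul (v : Series 𝕜 m) (r : 𝕜) (a : ScalarSeries 𝕜 m) :
    pre v (r • a) = r • pre v a := by
  funext ζ
  simp only [pre_eq_sum v _ (le_refl ζ.length), Pi.smul_apply, smul_eq_mul, Finset.mul_sum]
  exact Finset.sum_congr rfl fun η _ => by ring

theorem pre_zero (v : Series 𝕜 m) : pre v (0 : ScalarSeries 𝕜 m) = 0 := by
  simpa using pre_smul v 0 0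

theorem pre_sum {ι : Type*} (s : Finset ι) (v : Series 𝕜 m) (b : ι → ScalarSeries 𝕜 m) :
    pre v (∑ i ∈ s, b i) = ∑ i ∈ s, pre v (b i) := by
  classical
  induction s using Finset.induction_on with
  | empty => simp [pre_zero]
  | insert i s hi ih => rw [Finset.sum_insert hi, Finset.sum_insert hi, pre_add, ih]

theorem pre_add_left (v w : Series 𝕜 m) (e : ScalarSeries 𝕜 m) :
    pre (v + w) e = pre v e + pre w e := by
  funext ζ
  induction ζ generalizing e with
  | nil => simp [pre_nil]
  | cons x ζ ih =>
    simp only [pre_cons, Pi.add_apply, ih, component_add, add_shuffle, Finset.sum_add_distrib]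
    split_ifs <;> ring

theorem pre_smul_left (r : 𝕜) (v : Series 𝕜 m) (e : ScalarSeries 𝕜 m) :
    pre (r • v) e = r • pre v e := by
  funext ζ
  induction ζ generalizing e with
  | nil => simp [pre_nil]
  | cons x ζ ih =>
    simp only [pre_cons, Pi.smul_apply, ih, component_smul, smul_shuffle, smul_eq_mul,
      ← Finset.mul_sum]
    split_ifs <;> ring

theorem pre_sub_left (v w : Series 𝕜 m) (e : ScalarSeries 𝕜 m) :
    pre (v - w) e = pre v e - pre w e := by
  rw [sub_eq_add_neg, ← neg_one_smul 𝕜 w, pre_add_left, pre_smul_left, neg_one_smul,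
    sub_eq_add_neg]

theorem pre_sub (v : Series 𝕜 m) (a b : ScalarSeries 𝕜 m) :
    pre v (a - b) = pre v a - pre v b := by
  rw [sub_eq_add_neg, ← neg_one_smul 𝕜 b, pre_add, pre_smul, neg_one_smul, sub_eq_add_neg]

/-- The infinitesimal form of `comp_shuffle`: derivatives of multiplicative maps at the identity are
derivations. -/
theorem pre_shuffle (v : Series 𝕜 m) (a b : ScalarSeries 𝕜 m) :
    pre v (shuffle a b) = shuffle (pre v a) b + shuffle a (pre v b) := by
  funext ζ
  induction ζ generalizing a b with
  | nil => simp [pre_nil, shuffle_nil]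
  | cons x ζ ih =>
    simp only [pre_cons, Pi.add_apply, shuffle_cons, lshift_shuffle, pre_add, ih, lshift_pre,
      add_shuffle, shuffle_add]
    split_ifs
    · simp only [sum_shuffle, shuffle_sum, Finset.sum_apply,
        Finset.sum_add_distrib, shuffle_assoc, shuffle_left_comm a]
      ring
    · simp only [zero_shuffle, shuffle_zero, Pi.zero_apply]
      ring

theorem preLie_apply (c d : Series 𝕜 m) (ζ : Word m) (j : Fin m) :
    preLie c d ζ j = pre d (component c j.succ) ζ := by
  rw [preLie, finsum_word_eq_sum (N := ζ.length), pre_eq_sum d _ le_rfl, Finset.sum_apply]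
  · rfl
  · intro η hη
    rw [wordPreLie_eq_zero_of_length_lt _ _ _ hη, zero_smul]

theorem component_preLie (c d : Series 𝕜 m) (i : Fin (m + 1)) :
    component (preLie c d) i = pre d (component c i) := by
  refine Fin.cases ?_ (fun j => ?_) i
  · simp [pre_zero]
  · funext ζ
    rw [component_succ, preLie_apply]

/-- The right pre-Lie identity: the associator of the scalar action is symmetric. -/
theorem pre_pre_sub (b c : Series 𝕜 m) (e : ScalarSeries 𝕜 m) :
    pre c (pre b e) - pre (preLie b c) e = pre b (pre c e) - pre (preLie c b) e := by
  funext ζ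
  have h0 : ∀ (v w : Series 𝕜 m) (e : ScalarSeries 𝕜 m) (i : Fin (m + 1)),
      shuffle (component v i) (lshift i (pre w e)) =
        shuffle (component v i) (pre w (lshift i e)) := by
    intro v w e i
    refine Fin.cases ?_ (fun j => ?_) i
    · simp
    · rw [lshift_pre]
      simp
  -- By the Leibniz rule `pre c (b[i] ⧢ _)` produces the components of `preLie b c`, which cancel
  -- against the second term of the associator. The remaining `x_0` terms are symmetric in `b` and
  -- `c`.
  have h1 : ∀ (b c : Series 𝕜 m) (e : ScalarSeries 𝕜 m) (x : Fin (m + 1)) (ζ : Word m),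
      (pre c (pre b e) - pre (preLie b c) e) (x :: ζ) =
        (pre c (pre b (lshift x e)) - pre (preLie b c) (lshift x e)) ζ +
        if x = 0 then ∑ i, (shuffle (component b i) (pre c (lshift i e)) ζ +
          shuffle (component c i) (pre b (lshift i e)) ζ) else 0 := by
    intro b c e x ζ
    simp only [Pi.sub_apply, pre_cons, component_preLie, h0]
    rw [lshift_pre, pre_add, Pi.add_apply]
    split_ifs
    · simp only [pre_sum, pre_shuffle, Finset.sum_apply, Pi.add_apply, Finset.sum_add_distrib]
      ring
    · simp [pre_zero]
  induction ζ generalizing e with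
  | nil => simp [pre_nil]
  | cons x ζ ih =>
    rw [h1, h1, ih]
    congr 2
    exact Finset.sum_congr rfl fun i _ => add_comm _ _

theorem component_sub (c d : Series 𝕜 m) (i : Fin (m + 1)) :
    component (c - d) i = component c i - component d i := by
  rw [sub_eq_add_neg, ← neg_one_smul 𝕜 d, component_add, component_smul, neg_one_smul,
    sub_eq_add_neg]

theorem preLie_add_left (a b c : Series 𝕜 m) : preLie (a + b) c = preLie a c + preLie b c :=
  ext_component fun i => by simp only [component_preLie, component_add, pre_add]

theorem preLie_add_right (a b c : Series 𝕜 m) : preLie a (b + c) = preLie a b + preLie a c :=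
  ext_component fun i => by simp only [component_preLie, component_add, pre_add_left]

theorem preLie_smul_left (r : 𝕜) (a b : Series 𝕜 m) : preLie (r • a) b = r • preLie a b :=
  ext_component fun i => by simp only [component_preLie, component_smul, pre_smul]

theorem preLie_smul_right (r : 𝕜) (a b : Series 𝕜 m) : preLie a (r • b) = r • preLie a b :=
  ext_component fun i => by simp only [component_preLie, component_smul, pre_smul_left]

/-- The commutator of the pre-Lie product satisfies the Jacobi identity. -/
theorem preLie_jacobi (a b c : Series 𝕜 m) :
    let br := fun x y : Series 𝕜 m => preLie x y - preLie y x
    br a (br b c) + br b (br c a) + br c (br a b) = 0 := by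
  intro br
  refine ext_component fun i => ?_
  simp only [br, component_add, component_sub, component_preLie, pre_sub, pre_sub_left,
    component_zero_left]
  have h1 := pre_pre_sub b c (component a i)
  have h2 := pre_pre_sub c a (component b i)
  have h3 := pre_pre_sub a b (component c i)
  rw [sub_eq_iff_eq_add] at h1 h2 h3
  rw [h1, h2, h3]
  abel

/-! ### The derivative of the composition at zero -/

theorem shuffle_continuousAt {T : Type*} [TopologicalSpace T] {t₀ : T}
    {a b : T → ScalarSeries 𝕜 m} {ζ : Word m}
    (ha : ∀ ξ : Word m, ξ.length ≤ ζ.length → ContinuousAt (fun t => a t ξ) t₀)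
    (hb : ∀ ξ : Word m, ξ.length ≤ ζ.length → ContinuousAt (fun t => b t ξ) t₀) :
    ContinuousAt (fun t => shuffle (a t) (b t) ζ) t₀ := by
  induction ζ generalizing a b with
  | nil =>
    simp only [shuffle_nil]
    exact (ha [] le_rfl).mul (hb [] le_rfl)
  | cons x ζ ih =>
    simp only [shuffle_cons]
    exact (ih (fun ξ hξ => ha (x :: ξ) (by simpa using hξ))
        fun ξ hξ => hb ξ (hξ.trans (by simp))).add
      (ih (fun ξ hξ => ha ξ (hξ.trans (by simp))) fun ξ hξ => hb (x :: ξ) (by simpa using hξ))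

/-- In the recursion the `x_0` terms have an explicit factor `t`, so their derivative at `0` is the
value of the other factor there, where the composition is the identity. Only continuity of that
factor is needed. -/
theorem hasDerivAt_comp (v : Series 𝕜 m) (ζ : Word m) (e : ScalarSeries 𝕜 m) :
    HasDerivAt (fun t : 𝕜 => comp (t • v) e ζ) (pre v e ζ) 0 := by
  suffices H : ∀ n, ∀ ζ : Word m, ζ.length ≤ n → ∀ e : ScalarSeries 𝕜 m,
      HasDerivAt (fun t : 𝕜 => comp (t • v) e ζ) (pre v e ζ) 0 from H _ ζ le_rfl e
  intro n
  induction n with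
  | zero =>
    intro ζ hζ e
    obtain rfl := List.length_eq_zero_iff.mp (Nat.le_zero.mp hζ)
    simpa only [comp_nil, pre_nil] using hasDerivAt_const _ _
  | succ n ih =>
    rintro (_ | ⟨x, ζ⟩) hζ e
    · simpa only [comp_nil, pre_nil] using hasDerivAt_const _ _
    have hn : ζ.length ≤ n := by simpa using hζ
    simp only [comp_cons, pre_cons]
    refine (ih ζ hn _).add ?_
    split_ifs
    · refine HasDerivAt.fun_sum fun i _ => ?_
      simp only [component_smul, smul_shuffle, Pi.smul_apply, smul_eq_mul]
      have hc : ContinuousAt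
          (fun t : 𝕜 => shuffle (component v i) (comp (t • v) (lshift i e)) ζ) 0 :=
        shuffle_continuousAt (fun _ _ => continuousAt_const)
          fun ξ hξ => (ih ξ (hξ.trans hn) _).continuousAt
      rw [hasDerivAt_iff_tendsto_slope]
      have h1 := hc.tendsto.mono_left (nhdsWithin_le_nhds (s := {0}ᶜ))
      rw [zero_smul, comp_zero_left] at h1
      refine h1.congr' ?_
      filter_upwards [self_mem_nhdsWithin] with t ht
      have ht : t ≠ 0 := ht
      simp [slope_def_field, ht]
    · exact hasDerivAt_const _ _

end PreLie

/-! ### Growth estimates for the product and the inverse. -/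

section Estimates

variable {𝕜 : Type*} [RCLike 𝕜] {m : ℕ}

/-- The bound counts the positions that come from the first word. It follows from `shuffle_cons` by
Pascal's rule. -/
theorem norm_shuffle_le {a b : ScalarSeries 𝕜 m} {α β : ℕ → ℝ} {ζ : Word m}
    (ha : ∀ ξ : Word m, ξ.length ≤ ζ.length → ‖a ξ‖ ≤ α ξ.length)
    (hb : ∀ ξ : Word m, ξ.length ≤ ζ.length → ‖b ξ‖ ≤ β ξ.length) :
    ‖shuffle a b ζ‖ ≤
      ∑ p ∈ Finset.HasAntidiagonal.antidiagonal ζ.length, (ζ.length.choose p.1 : ℝ) * (α p.1 * β p.2) := by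
  induction ζ generalizing a b α β with
  | nil =>
    simp only [shuffle_nil, List.length_nil, Finset.HasAntidiagonal.antidiagonal_zero, Finset.sum_singleton,
      Nat.choose_self, Nat.cast_one, one_mul, norm_mul]
    have h1 := ha [] le_rfl
    exact mul_le_mul h1 (hb [] le_rfl) (norm_nonneg _) ((norm_nonneg _).trans h1)
  | cons x ζ ih =>
    rw [shuffle_cons, List.length_cons,
      Finset.sum_antidiagonal_choose_succ_mul (fun i j => α i * β j)]
    refine (norm_add_le _ _).trans ?_
    rw [add_comm]
    refine add_le_add ?_ ?_
    · exact ih (β := fun j => β (j + 1)) (fun ξ hξ => ha ξ (hξ.trans (by simp)))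
        fun ξ hξ => hb (x :: ξ) (by simpa using hξ)
    · refine (ih (α := fun j => α (j + 1)) (fun ξ hξ => ha (x :: ξ) (by simpa using hξ))
        fun ξ hξ => hb ξ (hξ.trans (by simp))).trans (le_of_eq ?_)
      refine Finset.sum_congr rfl fun p hp => ?_
      rw [← Finset.HasAntidiagonal.mem_antidiagonal.mp hp, Nat.choose_symm_add]

/-- The weights `1 / (n + 1) ^ 2`, which absorb convolutions. -/
def quadDecay (n : ℕ) : ℝ := 1 / ((n : ℝ) + 1) ^ 2

theorem quadDecay_pos (n : ℕ) : 0 < quadDecay n := by unfold quadDecay; positivity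

theorem quadDecay_le_one (n : ℕ) : quadDecay n ≤ 1 := by
  unfold quadDecay
  rw [div_le_one (by positivity)]
  nlinarith [(Nat.cast_nonneg n : (0 : ℝ) ≤ n)]

theorem quadDecay_le_succ (n : ℕ) : quadDecay n ≤ 4 * quadDecay (n + 1) := by
  unfold quadDecay
  have : (0 : ℝ) ≤ n := Nat.cast_nonneg n
  rw [mul_one_div, div_le_div_iff₀ (by positivity) (by positivity)]
  push_cast
  nlinarith

theorem sum_quadDecay_le (n : ℕ) : ∑ i ∈ Finset.range (n + 1), quadDecay i ≤ 2 := by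
  -- The sharper bound telescopes, while the bound `2` alone would not pass through the induction.
  have h : ∀ n : ℕ, ∑ i ∈ Finset.range (n + 1), quadDecay i ≤ 2 - 1 / ((n : ℝ) + 1) := by
    intro n
    induction n with
    | zero => norm_num [quadDecay]
    | succ n ih =>
      rw [Finset.sum_range_succ]
      have : (0 : ℝ) ≤ n := Nat.cast_nonneg n
      have h2 : quadDecay (n + 1) ≤ 1 / ((n : ℝ) + 1) - 1 / ((n : ℝ) + 1 + 1) := by
        unfold quadDecay
        rw [div_sub_div _ _ (by positivity) (by positivity),
          div_le_div_iff₀ (by positivity) (by positivity)]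
        push_cast
        nlinarith
      push_cast
      linarith
  have h3 : 0 ≤ 1 / ((n : ℝ) + 1) := by positivity
  linarith [h n]

/-- From `(a + b + 1) ^ 2 ≤ 2 ((a + 1) ^ 2 + (b + 1) ^ 2)` a product of weights is at most `2 *
quadDecay n` times their sum. Each weight sums to at most `2`, so the constant is `2 * (2 + 2)`. -/
theorem sum_quadDecay_mul_le (n : ℕ) :
    ∑ p ∈ Finset.HasAntidiagonal.antidiagonal n, quadDecay p.1 * quadDecay p.2 ≤ 8 * quadDecay n := by
  have h : ∀ p ∈ Finset.HasAntidiagonal.antidiagonal n, quadDecay p.1 * quadDecay p.2 ≤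
      2 * quadDecay n * (quadDecay p.1 + quadDecay p.2) := by
    rintro ⟨a, b⟩ hp
    have hab : a + b = n := Finset.HasAntidiagonal.mem_antidiagonal.mp hp
    subst hab
    have ha : (0 : ℝ) ≤ a := Nat.cast_nonneg a
    have hb : (0 : ℝ) ≤ b := Nat.cast_nonneg b
    unfold quadDecay
    push_cast
    rw [div_mul_div_comm, div_add_div _ _ (by positivity) (by positivity), mul_one_div,
      div_mul_div_comm, div_le_div_iff₀ (by positivity) (by positivity)]
    have h1 : ((a : ℝ) + b + 1) ^ 2 ≤ 2 * (((a : ℝ) + 1) ^ 2 + ((b : ℝ) + 1) ^ 2) := by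
      nlinarith [sq_nonneg ((a : ℝ) - b)]
    have h2 : 0 ≤ ((a : ℝ) + 1) ^ 2 * ((b : ℝ) + 1) ^ 2 := by positivity
    nlinarith [mul_le_mul_of_nonneg_left h1 h2]
  refine (Finset.sum_le_sum h).trans ?_
  rw [← Finset.mul_sum, Finset.sum_add_distrib,
    Finset.Nat.sum_antidiagonal_eq_sum_range_succ (fun i _ => quadDecay i),
    Finset.Nat.sum_antidiagonal_eq_sum_range_succ (fun _ j => quadDecay j)]
  have h4 : ∑ k ∈ Finset.range n.succ, quadDecay (n - k) =
      ∑ k ∈ Finset.range (n + 1), quadDecay k := by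
    rw [← Finset.sum_range_reflect]
    refine Finset.sum_congr rfl fun i hi => ?_
    rw [Finset.mem_range] at hi
    congr 1
    omega
  rw [h4]
  nlinarith [sum_quadDecay_le n, quadDecay_pos n]

theorem choose_mul_factorial_mul_le (n k : ℕ) {p : ℕ × ℕ} (hp : p ∈ Finset.HasAntidiagonal.antidiagonal n) :
    n.choose p.1 * (p.1.factorial * (k + p.2).factorial) ≤ (k + n).factorial := by
  obtain ⟨a, b⟩ := p
  have hab : a + b = n := Finset.HasAntidiagonal.mem_antidiagonal.mp hp
  calc n.choose a * (a.factorial * (k + b).factorial)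
      = n.descFactorial a * (k + b).factorial := by
        rw [Nat.descFactorial_eq_factorial_mul_choose]; ring
    _ ≤ (k + n).descFactorial a * (k + b).factorial :=
        Nat.mul_le_mul_right _ (Nat.descFactorial_le a (Nat.le_add_left n k))
    _ = (k + n).factorial := by
        rw [mul_comm, ← Nat.factorial_mul_descFactorial (n := k + n) (k := a) (by omega)]
        congr 2
        omega

/-- Induction on the length of `ζ`, where `k` counts the letters already shifted off `e`. One step
of the recursion gives a plain term and `m + 1` shuffles, each costing a factor `8 L` by the
convolution bound; it also costs `M` for the shift and `4` for passing from `quadDecay n` to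
`quadDecay (n + 1)`. The condition on `R` absorbs exactly this. The hypothesis on `d` is restricted
to lengths below `N` so that the lemma applies to a fixed point whose bound is still being proved.
-/
theorem norm_comp_le {d : Series 𝕜 m} {K L M R : ℝ} {N : ℕ} (hK : 0 ≤ K) (hL : 0 ≤ L)
    (hM : 0 ≤ M) (hR : 4 * M * (1 + 8 * (m + 1) * L) ≤ R)
    (hd : ∀ ξ : Word m, ξ.length < N → ∀ i,
      ‖component d i ξ‖ ≤ L * R ^ ξ.length * ξ.length.factorial * quadDecay ξ.length)
    (ζ : Word m) (hζ : ζ.length ≤ N) (k : ℕ) (e : ScalarSeries 𝕜 m)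
    (he : ∀ ξ, ‖e ξ‖ ≤ K * M ^ (k + ξ.length) * (k + ξ.length).factorial) :
    ‖comp d e ζ‖ ≤
      K * M ^ k * R ^ ζ.length * (k + ζ.length).factorial * quadDecay ζ.length := by
  have hR0 : 0 ≤ R := le_trans (by positivity) hR
  obtain ⟨n, hn⟩ : ∃ n, ζ.length = n := ⟨_, rfl⟩
  induction n using Nat.strong_induction_on generalizing ζ k e with
  | _ n ih =>
  cases ζ with
  | nil =>
    rw [comp_nil]
    simpa [quadDecay] using he []
  | cons x ζ =>
    obtain ⟨n, rfl⟩ : ∃ n', n = n' + 1 := ⟨ζ.length, by rw [← hn]; rfl⟩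
    have hl : ζ.length = n := by simpa using hn
    have hnN : n < N := by simp only [List.length_cons] at hζ; omega
    have hs : ∀ i, ∀ ξ, ‖lshift i e ξ‖ ≤
        K * M ^ ((k + 1) + ξ.length) * ((k + 1) + ξ.length).factorial := by
      intro i ξ
      have := he (i :: ξ)
      rw [List.length_cons, ← add_assoc, add_right_comm] at this
      exact this
    have IH : ∀ i, ∀ ξ : Word m, ξ.length ≤ n → ‖comp d (lshift i e) ξ‖ ≤ K * M ^ (k + 1) *
        R ^ ξ.length * ((k + 1) + ξ.length).factorial * quadDecay ξ.length :=
      fun i ξ hξ => ih ξ.length (by omega) ξ (by omega) (k + 1) _ (hs i) rfl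
    set A : ℝ := K * M ^ (k + 1) * R ^ n * ((k + 1) + n).factorial * quadDecay n with hA
    have h1 : ‖comp d (lshift x e) ζ‖ ≤ A := by
      have := IH x ζ hl.le
      rwa [hl] at this
    have h2 : ∀ i, ‖shuffle (component d i) (comp d (lshift i e)) ζ‖ ≤ 8 * L * A := by
      intro i
      refine (norm_shuffle_le (α := fun j => L * R ^ j * j.factorial * quadDecay j)
        (β := fun j => K * M ^ (k + 1) * R ^ j * ((k + 1) + j).factorial * quadDecay j)
        (fun ξ hξ => hd ξ (by omega) i) (fun ξ hξ => IH i ξ (by omega))).trans ?_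
      rw [hl]
      have h3 : ∀ p ∈ Finset.HasAntidiagonal.antidiagonal n,
          (n.choose p.1 : ℝ) * ((L * R ^ p.1 * p.1.factorial * quadDecay p.1) *
            (K * M ^ (k + 1) * R ^ p.2 * ((k + 1) + p.2).factorial * quadDecay p.2)) ≤
          (L * (K * M ^ (k + 1) * R ^ n) * ((k + 1) + n).factorial) *
            (quadDecay p.1 * quadDecay p.2) := by
        intro p hp
        have h4 : (n.choose p.1 : ℝ) * (p.1.factorial * ((k + 1) + p.2).factorial) ≤
            ((k + 1) + n).factorial := by
          exact_mod_cast choose_mul_factorial_mul_le n (k + 1) hp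
        have h5 : R ^ n = R ^ p.1 * R ^ p.2 := by
          rw [← pow_add, Finset.HasAntidiagonal.mem_antidiagonal.mp hp]
        have h6 : 0 ≤ L * (K * M ^ (k + 1) * R ^ n) * (quadDecay p.1 * quadDecay p.2) := by
          have := quadDecay_pos p.1
          have := quadDecay_pos p.2
          positivity
        calc _ = (L * (K * M ^ (k + 1) * R ^ n) * (quadDecay p.1 * quadDecay p.2)) *
              ((n.choose p.1 : ℝ) * (p.1.factorial * ((k + 1) + p.2).factorial)) := by
              rw [h5]; ring
          _ ≤ _ := mul_le_mul_of_nonneg_left h4 h6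
          _ = _ := by ring
      refine (Finset.sum_le_sum h3).trans ?_
      rw [← Finset.mul_sum]
      refine (mul_le_mul_of_nonneg_left (sum_quadDecay_mul_le n) (by positivity)).trans
        (le_of_eq ?_)
      rw [hA]; ring
    have hA0 : 0 ≤ A := (norm_nonneg _).trans h1
    have h7 : ‖comp d e (x :: ζ)‖ ≤ (1 + 8 * (m + 1) * L) * A := by
      rw [comp_cons]
      refine (norm_add_le _ _).trans ?_
      have h8 : ‖(if x = 0 then ∑ i, shuffle (component d i) (comp d (lshift i e)) ζ else 0 : 𝕜)‖
          ≤ (m + 1) * (8 * L * A) := by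
        split_ifs
        · refine (norm_sum_le _ _).trans ((Finset.sum_le_sum fun i _ => h2 i).trans ?_)
          simp
        · rw [norm_zero]; positivity
      nlinarith
    refine h7.trans ?_
    rw [List.length_cons, hl]
    have h9 : ((k + 1) + n).factorial = (k + (n + 1)).factorial := by congr 1; omega
    have hB : 0 ≤ K * M ^ k * R ^ n * ((k + (n + 1)).factorial : ℝ) := by positivity
    have hq := quadDecay_le_succ n
    have hq1 := quadDecay_pos (n + 1)
    calc (1 + 8 * (m + 1) * L) * A
        = (K * M ^ k * R ^ n * ((k + (n + 1)).factorial : ℝ)) *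
          ((M * (1 + 8 * (m + 1) * L)) * quadDecay n) := by rw [hA, h9]; ring
      _ ≤ (K * M ^ k * R ^ n * ((k + (n + 1)).factorial : ℝ)) *
          ((M * (1 + 8 * (m + 1) * L)) * (4 * quadDecay (n + 1))) := by
          gcongr
      _ ≤ (K * M ^ k * R ^ n * ((k + (n + 1)).factorial : ℝ)) * (R * quadDecay (n + 1)) := by
          refine mul_le_mul_of_nonneg_left ?_ hB
          nlinarith
      _ = _ := by ring

/-- The growth bound defining the bounded set number `n`. -/
def bnd (n l : ℕ) : ℝ := n * ((n : ℝ) ^ l * l.factorial)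

theorem bnd_nonneg (n l : ℕ) : 0 ≤ bnd n l := by unfold bnd; positivity

theorem bnd_mono {n n' : ℕ} (h : n ≤ n') (l : ℕ) : bnd n l ≤ bnd n' l := by
  unfold bnd
  gcongr

theorem norm_component_le {d : Series 𝕜 m} {r : ℝ} {ζ : Word m} (hr : 0 ≤ r)
    (h : ∀ j, ‖d ζ j‖ ≤ r) (i : Fin (m + 1)) : ‖component d i ζ‖ ≤ r := by
  refine Fin.cases ?_ (fun j => ?_) i
  · simpa using hr
  · exact h j

/-- The radius which bounds compositions and inverses of series in the bounded set `n`. -/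
def growth (m n : ℕ) : ℕ := 4 * n * (1 + 8 * (m + 1) * n)

theorem growth_spec (m n : ℕ) :
    4 * (n : ℝ) * (1 + 8 * (m + 1) * n) ≤ (growth m n : ℝ) := by
  unfold growth
  push_cast
  exact le_rfl

theorem four_mul_le_growth (m n : ℕ) : 4 * n ≤ growth m n :=
  Nat.le_mul_of_pos_right _ (by positivity)

theorem sq_le_four_pow (j : ℕ) : (j + 1) ^ 2 ≤ 4 ^ j := by
  rw [show 4 = 2 ^ 2 by rfl, ← pow_mul, mul_comm, pow_mul]
  exact Nat.pow_le_pow_left (Nat.lt_two_pow_self (n := j)) 2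

theorem norm_groupProd_le {c d : Series 𝕜 m} {n : ℕ} (hc : ∀ ζ j, ‖c ζ j‖ ≤ bnd n ζ.length)
    (hd : ∀ ζ j, ‖d ζ j‖ ≤ bnd n ζ.length) (ζ : Word m) (j : Fin m) :
    ‖groupProd c d ζ j‖ ≤ bnd (2 * growth m n) ζ.length := by
  have h4 := four_mul_le_growth m n
  have hd' : ∀ ξ : Word m, ξ.length < ζ.length + 1 → ∀ i, ‖component d i ξ‖ ≤
      (n : ℝ) * (growth m n : ℝ) ^ ξ.length * ξ.length.factorial * quadDecay ξ.length := by
    intro ξ _ i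
    refine (norm_component_le (bnd_nonneg _ _) (hd ξ) i).trans ?_
    obtain ⟨l, hl⟩ : ∃ l, ξ.length = l := ⟨_, rfl⟩
    rw [hl]
    -- The bounded sets carry no decaying weight. It is bought by enlarging the radius from `n` to
    -- `4 n`, because `(l + 1) ^ 2 ≤ 4 ^ l`.
    have h1 : (n : ℝ) ^ l * ((l : ℝ) + 1) ^ 2 ≤ (growth m n : ℝ) ^ l := by
      have : n ^ l * (l + 1) ^ 2 ≤ growth m n ^ l := by
        calc n ^ l * (l + 1) ^ 2 ≤ n ^ l * 4 ^ l := Nat.mul_le_mul_left _ (sq_le_four_pow l)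
          _ = (4 * n) ^ l := by rw [mul_pow, mul_comm]
          _ ≤ _ := Nat.pow_le_pow_left h4 l
      exact_mod_cast this
    have h2 : (n : ℝ) ^ l ≤ (growth m n : ℝ) ^ l * quadDecay l := by
      unfold quadDecay
      rw [mul_one_div, le_div_iff₀ (by positivity)]
      exact h1
    unfold bnd
    calc (n : ℝ) * ((n : ℝ) ^ l * l.factorial) = (n * l.factorial) * (n : ℝ) ^ l := by ring
      _ ≤ (n * l.factorial) * ((growth m n : ℝ) ^ l * quadDecay l) := by gcongr
      _ = _ := by ring
  have h := norm_comp_le (K := n) (L := n) (M := n) (R := growth m n) (by positivity)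
    (by positivity) (by positivity) (growth_spec m n) hd' ζ (by omega) 0 (component c j.succ)
    (fun ξ => by simpa [bnd, mul_assoc] using hc ξ j)
  have h' : ‖comp d (component c j.succ) ζ‖ ≤ bnd (growth m n) ζ.length := by
    refine h.trans ?_
    unfold bnd
    have h5 : (n : ℝ) ≤ growth m n := by exact_mod_cast (by omega : n ≤ growth m n)
    rw [pow_zero, mul_one, zero_add, ← mul_assoc]
    refine (mul_le_of_le_one_right (by positivity) (quadDecay_le_one _)).trans ?_
    gcongr
  have h6 : ‖d ζ j‖ ≤ bnd (growth m n) ζ.length :=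
    (hd ζ j).trans (bnd_mono (by omega) _)
  rw [groupProd_eq, Pi.add_apply, Pi.add_apply, mixedComp_apply]
  refine (norm_add_le _ _).trans ((add_le_add h6 h').trans ?_)
  generalize growth m n = r
  generalize ζ.length = l
  unfold bnd
  have : (r : ℝ) ^ l ≤ ((2 * r : ℕ) : ℝ) ^ l := by
    gcongr
    omega
  push_cast at this ⊢
  have h0 : (r : ℝ) * ((r : ℝ) ^ l * l.factorial) ≤ r * ((2 * r : ℝ) ^ l * l.factorial) := by
    gcongr
  linarith

/-- With `k = 0` and `K = L = M = n`, `norm_comp_le` returns at length `l` the same bound that it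
requires of shorter words, so strong induction closes. -/
theorem norm_fixSeries_le {s : 𝕜} (hs : ‖s‖ ≤ 1) {c : Series 𝕜 m} {n : ℕ}
    (hc : ∀ ζ j, ‖c ζ j‖ ≤ bnd n ζ.length) (ζ : Word m) (j : Fin m) :
    ‖fixSeries s c ζ j‖ ≤ bnd (growth m n) ζ.length := by
  have H : ∀ l, ∀ ξ : Word m, ξ.length = l → ∀ j, ‖fixSeries s c ξ j‖ ≤
      (n : ℝ) * (growth m n : ℝ) ^ ξ.length * ξ.length.factorial * quadDecay ξ.length := by
    intro l
    induction l using Nat.strong_induction_on with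
    | _ l ih =>
    intro ξ hξ j
    have h := norm_comp_le (d := fixSeries s c) (K := n) (L := n) (M := n) (R := growth m n)
      (N := l) (by positivity) (by positivity) (by positivity) (growth_spec m n)
      (fun η hη i => norm_component_le
        (by have := quadDecay_pos η.length; positivity) (ih _ hη η rfl) i)
      ξ hξ.le 0 (component c j.succ) (fun ξ => by simpa [bnd, mul_assoc] using hc ξ j)
    rw [fixSeries_apply, norm_mul]
    refine (mul_le_of_le_one_left (norm_nonneg _) hs).trans (h.trans (le_of_eq ?_))
    simp
  refine (H _ ζ rfl j).trans ?_
  have h5 : (n : ℝ) ≤ growth m n := by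
    exact_mod_cast (by have := four_mul_le_growth m n; omega : n ≤ growth m n)
  unfold bnd
  rw [← mul_assoc]
  refine (mul_le_of_le_one_right (by positivity) (quadDecay_le_one _)).trans ?_
  gcongr

end Estimates

end Series

/-! ### Topological vector spaces determined by an exhaustion by compact sets. -/

section SilvaExhaustion

variable (𝕜 : Type*) [RCLike 𝕜]

/-- The finite sums `∑ ε_k b_k` with `b_k ∈ B_k`. -/
def finiteSums {X : Type*} [AddCommGroup X] [Module 𝕜 X] (B : ℕ → Set X) (ε : ℕ → ℝ) : Set X :=
  {x | ∃ (N : ℕ) (b : ℕ → X), (∀ k, b k ∈ B k) ∧ (∀ k, N ≤ k → b k = 0) ∧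
    x = ∑ k ∈ Finset.range N, (ε k : 𝕜) • b k}

/-- An exhaustion of a topological vector space by compact sets which determines the
neighbourhoods of zero in the way the unit balls of the steps of a Silva space do. -/
structure IsSilvaExhaustion {X : Type*} [AddCommGroup X] [Module 𝕜 X] [TopologicalSpace X]
    (B : ℕ → Set X) : Prop where
  compact : ∀ n, IsCompact (B n)
  mono : Monotone B
  zero_mem : ∀ n, (0 : X) ∈ B n
  exhaust : ∀ x, ∃ n, x ∈ B n
  add : ∀ n, ∃ n', ∀ x ∈ B n, ∀ y ∈ B n, x + y ∈ B n'
  smul : ∀ n, ∀ x ∈ B n, ∀ r : 𝕜, ‖r‖ ≤ 1 → r • x ∈ B n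
  nhds : ∀ ε : ℕ → ℝ, (∀ k, 0 < ε k) → finiteSums 𝕜 B ε ∈ 𝓝 (0 : X)

variable {𝕜}

theorem sum_range_eq_of_le {X : Type*} [AddCommGroup X] [Module 𝕜 X] {N N' : ℕ} (h : N ≤ N')
    (ε : ℕ → ℝ) {b : ℕ → X} (hb : ∀ k, N ≤ k → b k = 0) :
    ∑ k ∈ Finset.range N, (ε k : 𝕜) • b k = ∑ k ∈ Finset.range N', (ε k : 𝕜) • b k := by
  refine Finset.sum_subset (Finset.range_subset_range.mpr h) fun k _ hk => ?_
  rw [hb k (by simpa using hk), smul_zero]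

namespace IsSilvaExhaustion

variable {X Y Z : Type*} [AddCommGroup X] [Module 𝕜 X] [TopologicalSpace X]
  [AddCommGroup Y] [Module 𝕜 Y] [TopologicalSpace Y] [TopologicalSpace Z]

/-- Terms that vanish eventually can be padded, so both finite sums run over the same range. Joint
continuity of the multiplication rests on this. -/
theorem prod {B : ℕ → Set X} {C : ℕ → Set Y} (hB : IsSilvaExhaustion 𝕜 B)
    (hC : IsSilvaExhaustion 𝕜 C) : IsSilvaExhaustion 𝕜 fun n => B n ×ˢ C n where
  compact n := (hB.compact n).prod (hC.compact n)
  mono _ _ h := Set.prod_mono (hB.mono h) (hC.mono h)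
  zero_mem n := ⟨hB.zero_mem n, hC.zero_mem n⟩
  exhaust x := by
    obtain ⟨n, hn⟩ := hB.exhaust x.1
    obtain ⟨n', hn'⟩ := hC.exhaust x.2
    exact ⟨max n n', hB.mono (le_max_left _ _) hn, hC.mono (le_max_right _ _) hn'⟩
  add n := by
    obtain ⟨n₁, h₁⟩ := hB.add n
    obtain ⟨n₂, h₂⟩ := hC.add n
    exact ⟨max n₁ n₂, fun x hx y hy =>
      ⟨hB.mono (le_max_left _ _) (h₁ _ hx.1 _ hy.1), hC.mono (le_max_right _ _) (h₂ _ hx.2 _ hy.2)⟩⟩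
  smul n x hx r hr := ⟨hB.smul n _ hx.1 r hr, hC.smul n _ hx.2 r hr⟩
  nhds ε hε := by
    refine mem_of_superset (prod_mem_nhds (hB.nhds ε hε) (hC.nhds ε hε)) ?_
    rintro ⟨x, y⟩ ⟨⟨N, b, hb, hb0, rfl⟩, ⟨N', c, hc, hc0, rfl⟩⟩
    refine ⟨max N N', fun k => (b k, c k), fun k => ⟨hb k, hc k⟩, fun k hk => ?_, ?_⟩
    · beta_reduce
      rw [hb0 k (le_of_max_le_left hk), hc0 k (le_of_max_le_right hk)]
      rfl
    · refine Prod.ext ?_ ?_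
      · simp only [Prod.fst_sum, Prod.smul_fst]
        exact sum_range_eq_of_le (le_max_left _ _) ε hb0
      · simp only [Prod.snd_sum, Prod.smul_snd]
        exact sum_range_eq_of_le (le_max_right _ _) ε hc0

theorem pi {ι : Type*} [Fintype ι] {B : ℕ → Set X} (hB : IsSilvaExhaustion 𝕜 B) :
    IsSilvaExhaustion 𝕜 fun n => Set.univ.pi fun _ : ι => B n where
  compact n := isCompact_univ_pi fun _ => hB.compact n
  mono _ _ h := Set.pi_mono fun _ _ => hB.mono h
  zero_mem n := fun _ _ => hB.zero_mem n
  exhaust x := by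
    choose n hn using fun i => hB.exhaust (x i)
    exact ⟨Finset.univ.sup n, fun i _ => hB.mono (Finset.le_sup (Finset.mem_univ i)) (hn i)⟩
  add n := by
    obtain ⟨n₁, h₁⟩ := hB.add n
    exact ⟨n₁, fun x hx y hy i hi => h₁ _ (hx i hi) _ (hy i hi)⟩
  smul n x hx r hr := fun i hi => hB.smul n _ (hx i hi) r hr
  nhds ε hε := by
    refine mem_of_superset (set_pi_mem_nhds Set.finite_univ fun _ _ => hB.nhds ε hε) ?_
    intro x hx
    choose N b hb hb0 hx using fun i => hx i (Set.mem_univ i)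
    refine ⟨Finset.univ.sup N, fun k i => b i k, fun k i _ => hb i k, fun k hk => ?_, ?_⟩
    · funext i
      exact hb0 i k ((Finset.le_sup (Finset.mem_univ i)).trans hk)
    · funext i
      rw [Finset.sum_apply, hx i]
      exact sum_range_eq_of_le (Finset.le_sup (Finset.mem_univ i)) ε (hb0 i)

variable [IsTopologicalAddGroup X] [ContinuousSMul 𝕜 X] {B : ℕ → Set X}

/-- All sums of `K` and `B k` lie in one `B n'`, where `V` is relatively open. Compactness of `K`
leaves room for a neighbourhood `U` with `K + U ⊆ O`, and `U` absorbs the compact set `B k`. -/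
theorem exists_smul_add_subset (hB : IsSilvaExhaustion 𝕜 B) {K V : Set X}
    (hV : ∀ n, ∃ O, IsOpen O ∧ O ∩ B n ⊆ V ∧ V ∩ B n ⊆ O)
    (hK : IsCompact K) (hKV : K ⊆ V) {n : ℕ} (hn : K ⊆ B n) (k : ℕ) :
    ∃ ε : ℝ, 0 < ε ∧ ∃ K' : Set X, IsCompact K' ∧ K' ⊆ V ∧ (∃ n', K' ⊆ B n') ∧
      ∀ x ∈ K, ∀ b ∈ B k, x + (ε : 𝕜) • b ∈ K' := by
  obtain ⟨n', hn'⟩ := hB.add (max n k)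
  obtain ⟨O, hO, hO1, hO2⟩ := hV n'
  have hadd : ∀ x ∈ K, ∀ y ∈ B k, x + y ∈ B n' := fun x hx y hy =>
    hn' x (hB.mono (le_max_left _ _) (hn hx)) y (hB.mono (le_max_right _ _) hy)
  have hKO : K ⊆ O := fun x hx => hO2
    ⟨hKV hx, by simpa using hadd x hx 0 (hB.zero_mem k)⟩
  obtain ⟨U, hU, hKU⟩ := compact_open_separated_add_right hK hO hKO
  have habs := ((hB.compact k).isVonNBounded 𝕜 hU).eventually_nhds_zero (mem_of_mem_nhds hU)
  obtain ⟨δ, hδ, hball⟩ := Metric.eventually_nhds_iff.mp habs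
  -- Here `δ / 2` keeps the scalar strictly inside the absorbing ball, and `1` keeps the scaled
  -- vector in `B k`.
  have hε : ‖((min (δ / 2) 1 : ℝ) : 𝕜)‖ = min (δ / 2) 1 := by
    rw [RCLike.norm_ofReal, abs_of_pos (by positivity)]
  refine ⟨min (δ / 2) 1, by positivity,
    (fun p : X × X => p.1 + ((min (δ / 2) 1 : ℝ) : 𝕜) • p.2) '' (K ×ˢ B k), ?_, ?_, ⟨n', ?_⟩, ?_⟩
  · exact (hK.prod (hB.compact k)).image (by fun_prop)
  · rintro _ ⟨⟨x, b⟩, ⟨hx, hb⟩, rfl⟩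
    refine hO1 ⟨hKU (Set.add_mem_add hx (hball ?_ hb)),
      hadd x hx _ (hB.smul k b hb _ (hε.le.trans (min_le_right _ _)))⟩
    rw [dist_zero_right, hε]
    exact (min_le_left _ _).trans_lt (by linarith)
  · rintro _ ⟨⟨x, b⟩, ⟨hx, hb⟩, rfl⟩
    exact hadd x hx _ (hB.smul k b hb _ (hε.le.trans (min_le_right _ _)))
  · exact fun x hx b hb => ⟨(x, b), ⟨hx, hb⟩, rfl⟩

/-- Starting from `{0}`, compact sets inside `V` are enlarged successively by `ε_k B_k`, with `ε_k`
chosen after the compact set reached so far. All finite sums `∑ ε_k b_k` then stay in `V`, and they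
form a neighbourhood of zero. -/
theorem mem_nhds_zero (hB : IsSilvaExhaustion 𝕜 B) {V : Set X}
    (hV : ∀ n, ∃ O, IsOpen O ∧ O ∩ B n ⊆ V ∧ V ∩ B n ⊆ O) (h0 : (0 : X) ∈ V) :
    V ∈ 𝓝 (0 : X) := by
  let S := {K : Set X // IsCompact K ∧ K ⊆ V ∧ ∃ n, K ⊆ B n}
  have step : ∀ (K : S) (k : ℕ), ∃ ε : ℝ, 0 < ε ∧ ∃ K' : S,
      ∀ x ∈ K.1, ∀ b ∈ B k, x + (ε : 𝕜) • b ∈ K'.1 := by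
    rintro ⟨K, hK, hKV, n, hn⟩ k
    obtain ⟨ε, hε, K', h1, h2, h3, h4⟩ := hB.exists_smul_add_subset hV hK hKV hn k
    exact ⟨ε, hε, ⟨K', h1, h2, h3⟩, h4⟩
  choose ε hε next hnext using step
  let K₀ : S := ⟨{0}, isCompact_singleton, Set.singleton_subset_iff.mpr h0, 0,
    Set.singleton_subset_iff.mpr (hB.zero_mem 0)⟩
  let seq : ℕ → S := fun N => Nat.rec K₀ (fun k K => next K k) N
  refine mem_of_superset (hB.nhds (fun k => ε (seq k) k) fun k => hε _ _) ?_
  rintro _ ⟨N, b, hb, -, rfl⟩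
  have key : ∀ N, ∑ k ∈ Finset.range N, (ε (seq k) k : 𝕜) • b k ∈ (seq N).1 := by
    intro N
    induction N with
    | zero => exact Set.mem_singleton _
    | succ N ih =>
      rw [Finset.sum_range_succ]
      exact hnext (seq N) N _ ih _ (hb N)
  exact (seq N).2.2.1 (key N)

/-- A map is continuous if its restrictions to the compact sets of the exhaustion are. -/
theorem continuous_of_continuousOn (hB : IsSilvaExhaustion 𝕜 B) {f : X → Z}
    (hf : ∀ n, ContinuousOn f (B n)) : Continuous f := by
  have h0 : ∀ g : X → Z, (∀ n, ContinuousOn g (B n)) → ContinuousAt g 0 := by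
    intro g hg
    refine continuousAt_def.mpr fun W hW => ?_
    obtain ⟨W', hW', hopen, hmem⟩ := mem_nhds_iff.mp hW
    refine mem_of_superset (hB.mem_nhds_zero (V := g ⁻¹' W') (fun n => ?_) hmem)
      (Set.preimage_mono hW')
    obtain ⟨O, hO, h⟩ := continuousOn_iff'.mp (hg n) W' hopen
    exact ⟨O, hO, fun x hx => (h.symm.subset hx).1, fun x hx => (h.subset hx).1⟩
  refine continuous_iff_continuousAt.mpr fun x => ?_
  -- Continuity at `x` reduces to continuity at `0` by translation, since `x + B n` lies in some `B
  -- n'`.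
  have h1 : ContinuousAt (fun y => f (x + y)) 0 := by
    refine h0 _ fun n => ?_
    obtain ⟨n₀, hx⟩ := hB.exhaust x
    obtain ⟨n', hn'⟩ := hB.add (max n₀ n)
    exact (hf n').comp (by fun_prop) fun y hy =>
      hn' x (hB.mono (le_max_left _ _) hx) y (hB.mono (le_max_right _ _) hy)
  have h2 : ContinuousAt (fun y => f (x + (y - x))) x := by
    refine ContinuousAt.comp (g := fun y => f (x + y)) (f := fun y => y - x) ?_ (by fun_prop)
    simpa using h1
  simpa using h2

end IsSilvaExhaustion

end SilvaExhaustion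

/-! ### The Silva topology on locally convergent series. -/

namespace LCSeries

variable {𝕜 : Type*} [RCLike 𝕜] {m : ℕ}

theorem toSeries_injective : Function.Injective (toSeries : LCSeries 𝕜 m → Series 𝕜 m) :=
  Subtype.val_injective

@[simp] theorem toSeries_add (c d : LCSeries 𝕜 m) :
    (c + d).toSeries = c.toSeries + d.toSeries := rfl

@[simp] theorem toSeries_sub (c d : LCSeries 𝕜 m) :
    (c - d).toSeries = c.toSeries - d.toSeries := rfl

@[simp] theorem toSeries_smul (r : 𝕜) (c : LCSeries 𝕜 m) :
    (r • c).toSeries = r • c.toSeries := rfl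

@[simp] theorem toSeries_zero : (0 : LCSeries 𝕜 m).toSeries = 0 := rfl

theorem toSeries_real_smul (r : ℝ) (c : LCSeries 𝕜 m) :
    (r • c).toSeries = r • c.toSeries := rfl

variable (𝕜 m) in
/-- The sets of series with `|(c, η)| ≤ n * n ^ |η| * |η|!`. -/
def boundedSet (n : ℕ) : Set (LCSeries 𝕜 m) :=
  {c | ∀ ζ j, ‖c.toSeries ζ j‖ ≤ Series.bnd n ζ.length}

/-- A series with coefficients bounded by `n * n ^ |η| * |η|!` is locally convergent. -/
def ofBounded (n : ℕ) (c : Series 𝕜 m) (h : ∀ ζ j, ‖c ζ j‖ ≤ Series.bnd n ζ.length) :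
    LCSeries 𝕜 m :=
  ⟨c, n, n, by positivity, by positivity, fun ζ =>
    (pi_norm_le_iff_of_nonneg (Series.bnd_nonneg _ _)).mpr (h ζ)⟩

@[simp] theorem toSeries_ofBounded (n : ℕ) (c : Series 𝕜 m)
    (h : ∀ ζ j, ‖c ζ j‖ ≤ Series.bnd n ζ.length) : (ofBounded n c h).toSeries = c := rfl

theorem exists_mem_boundedSet (c : LCSeries 𝕜 m) : ∃ n, c ∈ boundedSet 𝕜 m n := by
  obtain ⟨K, M, hK, hM, h⟩ := c.2
  obtain ⟨n, hn⟩ := exists_nat_ge (max K M)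
  refine ⟨n, fun ζ j => (norm_le_pi_norm _ j).trans ((h ζ).trans ?_)⟩
  have h1 : K ≤ n := (le_max_left _ _).trans hn
  have h2 : M ≤ n := (le_max_right _ _).trans hn
  unfold weight Series.bnd
  gcongr

theorem boundedSet_mono : Monotone (boundedSet 𝕜 m) := fun _ _ h _ hc ζ j =>
  (hc ζ j).trans (Series.bnd_mono h _)

theorem bnd_add_bnd_le (n l : ℕ) :
    Series.bnd n l + Series.bnd n l ≤ Series.bnd (2 * n) l := by
  unfold Series.bnd
  have : (n : ℝ) ^ l ≤ ((2 * n : ℕ) : ℝ) ^ l := by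
    gcongr
    omega
  have h0 : (n : ℝ) * ((n : ℝ) ^ l * l.factorial) ≤ n * (((2 * n : ℕ) : ℝ) ^ l * l.factorial) := by
    gcongr
  push_cast at h0 ⊢
  linarith

/-- The topology of coefficientwise convergence is itself admissible, and the Silva topology is
finer than every admissible one. -/
theorem continuous_toSeries : Continuous (toSeries : LCSeries 𝕜 m → Series 𝕜 m) := by
  rw [continuous_iff_le_induced]
  refine sInf_le ⟨?_, ?_, ?_, fun M => ?_⟩
  · exact topologicalAddGroup_induced (lcSubmodule 𝕜 m).subtype
  · exact continuousSMul_induced (lcSubmodule 𝕜 m).subtype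
  · exact LocallyConvexSpace.induced ((lcSubmodule 𝕜 m).subtype.restrictScalars ℝ)
  · rw [continuous_induced_rng]
    have h1 : Continuous fun c : LInf 𝕜 m M => (LInf.rescale 𝕜 m M c : Word m → Fin m → 𝕜) :=
      (lp.uniformContinuous_coe.continuous).comp continuous_induced_dom
    have h2 : (toSeries ∘ LInf.incl 𝕜 m M) = fun c : LInf 𝕜 m M => fun η =>
        (weight M.1 η) • (LInf.rescale 𝕜 m M c : Word m → Fin m → 𝕜) η := by
      funext c η
      exact (smul_inv_smul₀ (weight_pos M.2 η).ne' (c.1 η)).symm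
    rw [h2]
    exact continuous_pi fun η => ((continuous_apply η).comp h1).const_smul (weight M.1 η)

instance : T2Space (LCSeries 𝕜 m) := T2Space.of_injective_continuous toSeries_injective
  continuous_toSeries

theorem continuous_coeff (ζ : Word m) (j : Fin m) :
    Continuous fun c : LCSeries 𝕜 m => c.toSeries ζ j :=
  (continuous_apply j).comp ((continuous_apply ζ).comp continuous_toSeries)

/-- A positive exponential scale dominating the bounded set `n`. -/
def bigScale (n : ℕ) : Set.Ioi (0 : ℝ) := ⟨2 * n + 1, by simp only [Set.mem_Ioi]; positivity⟩

/-- The factor `(1 / 2) ^ |ζ|` makes the tails of a bounded set uniformly small in a larger step.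
This is the compactness of the inclusions between the steps. -/
theorem bnd_le_bigScale (n : ℕ) (ζ : Word m) :
    Series.bnd n ζ.length ≤ n * (1 / 2) ^ ζ.length * weight (bigScale n).1 ζ := by
  unfold Series.bnd weight bigScale
  have : (n : ℝ) ^ ζ.length ≤ (1 / 2) ^ ζ.length * (2 * n + 1 : ℝ) ^ ζ.length := by
    rw [← mul_pow]
    gcongr
    linarith
  calc (n : ℝ) * ((n : ℝ) ^ ζ.length * ζ.length.factorial)
      ≤ n * (((1 / 2) ^ ζ.length * (2 * n + 1 : ℝ) ^ ζ.length) * ζ.length.factorial) := by gcongr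
    _ = _ := by ring

/-- The elements of the bounded set `n` as elements of a Banach step. -/
def toLInf (n : ℕ) (c : LCSeries 𝕜 m) (hc : c ∈ boundedSet 𝕜 m n) : LInf 𝕜 m (bigScale n) :=
  ⟨c.toSeries, n, fun ζ => by
    rw [div_le_iff₀ (weight_pos (bigScale n).2 ζ)]
    refine (pi_norm_le_iff_of_nonneg ?_).mpr fun j => (hc ζ j).trans ?_
    · exact mul_nonneg (by positivity) (weight_pos (bigScale n).2 ζ).le
    · refine (bnd_le_bigScale n ζ).trans (mul_le_mul_of_nonneg_right ?_
        (weight_pos (bigScale n).2 ζ).le)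
      exact mul_le_of_le_one_right (by positivity) (pow_le_one₀ (by norm_num) (by norm_num))⟩

@[simp] theorem incl_toLInf (n : ℕ) (c : LCSeries 𝕜 m) (hc : c ∈ boundedSet 𝕜 m n) :
    LInf.incl 𝕜 m _ (toLInf n c hc) = c := rfl

/-- In the norm of the larger step, long words are uniformly small and the finitely many short ones
are handled by coefficientwise convergence. The inclusion of that step is continuous. -/
theorem tendsto_zero_of_coeff {T : Type*} {F : Filter T} {g : T → LCSeries 𝕜 m} {n : ℕ}
    (hg : ∀ᶠ t in F, g t ∈ boundedSet 𝕜 m n)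
    (hc : ∀ ζ j, Tendsto (fun t => (g t).toSeries ζ j) F (𝓝 0)) : Tendsto g F (𝓝 0) := by
  classical
  let a : T → LInf 𝕜 m (bigScale n) := fun t =>
    if h : g t ∈ boundedSet 𝕜 m n then toLInf n (g t) h else 0
  have ha : Tendsto a F (𝓝 0) := by
    rw [Metric.tendsto_nhds]
    intro ε hε
    obtain ⟨l₀, hl₀⟩ : ∃ l₀ : ℕ, (n : ℝ) * (1 / 2) ^ l₀ ≤ ε / 2 := by
      have : Tendsto (fun l : ℕ => (n : ℝ) * (1 / 2 : ℝ) ^ l) atTop (𝓝 (n * 0)) :=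
        (tendsto_pow_atTop_nhds_zero_of_lt_one (by norm_num) (by norm_num)).const_mul _
      rw [mul_zero] at this
      exact (this.eventually (ge_mem_nhds (half_pos hε))).exists
    have hfin : ∀ᶠ t in F, ∀ ζ ∈ Series.wordsLe m l₀, ∀ j,
        ‖(g t).toSeries ζ j‖ ≤ ε / 2 * weight (bigScale n).1 ζ := by
      rw [Filter.eventually_all_finset]
      intro ζ _
      rw [eventually_all]
      intro j
      have h1 := (hc ζ j).norm
      rw [norm_zero] at h1
      exact h1.eventually (ge_mem_nhds (mul_pos (half_pos hε) (weight_pos (bigScale n).2 ζ)))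
    filter_upwards [hg, hfin] with t ht hft
    have hat : a t = toLInf n (g t) ht := dif_pos ht
    rw [dist_zero_right, hat, LInf.norm_eq]
    refine lt_of_le_of_lt (ciSup_le fun ζ => ?_) (half_lt_self hε)
    have hw := weight_pos (bigScale n).2 ζ
    rw [div_le_iff₀ hw]
    refine (pi_norm_le_iff_of_nonneg (by positivity)).mpr fun j => ?_
    by_cases hζ : ζ.length ≤ l₀
    · exact hft ζ (Series.mem_wordsLe.mpr hζ) j
    · refine (ht ζ j).trans ((bnd_le_bigScale n ζ).trans
        (mul_le_mul_of_nonneg_right (le_trans ?_ hl₀) hw.le))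
      exact mul_le_mul_of_nonneg_left
        (pow_le_pow_of_le_one (by norm_num) (by norm_num) (by omega)) (by positivity)
  have h2 := ((continuous_incl 𝕜 m (bigScale n)).tendsto 0).comp ha
  rw [map_zero] at h2
  refine h2.congr' ?_
  filter_upwards [hg] with t ht
  simp only [Function.comp_apply, a, dif_pos ht, incl_toLInf]

/-- On the bounded sets, convergence is convergence of the coefficients. -/
theorem tendsto_of_coeff {T : Type*} {F : Filter T} {g : T → LCSeries 𝕜 m} {L : LCSeries 𝕜 m}
    {n : ℕ} (hg : ∀ᶠ t in F, g t ∈ boundedSet 𝕜 m n) (hL : L ∈ boundedSet 𝕜 m n)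
    (hc : ∀ ζ j, Tendsto (fun t => (g t).toSeries ζ j) F (𝓝 (L.toSeries ζ j))) :
    Tendsto g F (𝓝 L) := by
  have h : Tendsto (fun t => g t - L) F (𝓝 0) := by
    refine tendsto_zero_of_coeff (n := 2 * n) ?_ fun ζ j => ?_
    · filter_upwards [hg] with t ht ζ j
      exact (norm_sub_le _ _).trans ((add_le_add (ht ζ j) (hL ζ j)).trans (bnd_add_bnd_le _ _))
    · simpa using (hc ζ j).sub_const (L.toSeries ζ j)
  simpa using h.add_const L

/-- The corresponding box in the product space is compact by Tychonoff, and on it the map into the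
Silva space is continuous by `tendsto_of_coeff`. -/
theorem isCompact_boundedSet (n : ℕ) : IsCompact (boundedSet 𝕜 m n) := by
  let K : Set (Series 𝕜 m) := Set.univ.pi fun ζ => Set.univ.pi fun _ =>
    Metric.closedBall (0 : 𝕜) (Series.bnd n ζ.length)
  have hK : IsCompact K := isCompact_univ_pi fun ζ => isCompact_univ_pi fun _ =>
    isCompact_closedBall _ _
  have hmem : ∀ s : K, ∀ ζ j, ‖s.1 ζ j‖ ≤ Series.bnd n ζ.length := fun s ζ j => by
    simpa using s.2 ζ trivial j trivial
  have : CompactSpace K := isCompact_iff_compactSpace.mp hK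
  have hcont : Continuous fun s : K => ofBounded n s.1 (hmem s) := by
    refine continuous_iff_continuousAt.mpr fun s => ?_
    refine tendsto_of_coeff (n := n) (Eventually.of_forall fun t => hmem t) (hmem s) fun ζ j => ?_
    exact ((continuous_apply j).comp ((continuous_apply ζ).comp continuous_subtype_val)).tendsto s
  convert isCompact_range hcont
  ext c
  constructor
  · exact fun hc => ⟨⟨c.toSeries, fun ζ _ j _ => by simpa using hc ζ j⟩, rfl⟩
  · rintro ⟨s, rfl⟩
    exact hmem s

/-- The gauge of `U` is a seminorm whose topology is admissible, because `U` absorbs the unit ball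
of every Banach step. The Silva topology is finer, and the set where the gauge is below `1` lies in
`U`. -/
theorem mem_nhds_zero_of_absorbs {U : Set (LCSeries 𝕜 m)} (hb : Balanced 𝕜 U) (hc : Convex ℝ U)
    (h : ∀ n, ∃ r : ℝ, 0 < r ∧ ∀ c ∈ boundedSet 𝕜 m n, (r : 𝕜) • c ∈ U) :
    U ∈ 𝓝 (0 : LCSeries 𝕜 m) := by
  have h0 : (0 : LCSeries 𝕜 m) ∈ U := by
    obtain ⟨r, -, hr⟩ := h 0
    simpa using hr 0 fun ζ j => by simpa using Series.bnd_nonneg 0 ζ.length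
  have real_mem : ∀ {n : ℕ} {r s : ℝ}, (∀ c ∈ boundedSet 𝕜 m n, (r : 𝕜) • c ∈ U) → 0 < r →
      |s| ≤ r → ∀ c ∈ boundedSet 𝕜 m n, s • c ∈ U := by
    intro n r s hr hr0 hs c hc
    have := hb.smul_mem (a := ((s / r : ℝ) : 𝕜)) (by
      rw [RCLike.norm_ofReal, abs_div, abs_of_pos hr0]
      exact div_le_one_of_le₀ hs hr0.le) (hr c hc)
    rwa [smul_smul, ← RCLike.ofReal_mul, div_mul_cancel₀ _ hr0.ne',
      ← RCLike.real_smul_eq_coe_smul] at this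
  have habs : Absorbent ℝ U := by
    rw [absorbent_iff_eventually_nhdsNE_zero]
    intro c
    obtain ⟨n, hn⟩ := exists_mem_boundedSet c
    obtain ⟨r, hr0, hr⟩ := h n
    refine Filter.Eventually.filter_mono nhdsWithin_le_nhds ?_
    filter_upwards [Metric.closedBall_mem_nhds (0 : ℝ) hr0] with s hs
    exact real_mem hr hr0 (by simpa using hs) c hn
  let p : SeminormFamily 𝕜 (LCSeries 𝕜 m) Unit := fun _ => gaugeSeminorm hb hc habs
  let t : TopologicalSpace (LCSeries 𝕜 m) := p.moduleFilterBasis.topology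
  have hp : @WithSeminorms _ _ _ _ _ _ p t := @WithSeminorms.mk _ _ _ _ _ _ p t rfl
  have hadm : t ∈ admissibleTopologies 𝕜 m := by
    refine ⟨hp.topologicalAddGroup, hp.continuousSMul, hp.toLocallyConvexSpace, fun M => ?_⟩
    have : @IsTopologicalAddGroup _ t _ := hp.topologicalAddGroup
    refine continuous_of_continuousAt_zero (LInf.incl 𝕜 m M) ?_
    rw [ContinuousAt, map_zero, hp.tendsto_nhds]
    intro _ ε hε
    -- With `n ≥ M` and `n ≥ 1` the unit ball of `ℓ_{∞, M}` lies in `boundedSet n`.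
    obtain ⟨n, hn⟩ := exists_nat_ge (max 1 M.1)
    have hn1 : (1 : ℝ) ≤ n := (le_max_left _ _).trans hn
    have hnM : M.1 ≤ n := (le_max_right _ _).trans hn
    obtain ⟨r, hr0, hr⟩ := h n
    have hδ : 0 < ε / 2 * r := by positivity
    filter_upwards [Metric.closedBall_mem_nhds (0 : LInf 𝕜 m M) hδ] with c hc
    rw [Metric.mem_closedBall, dist_zero_right] at hc
    have hcoef : ∀ ζ j, ‖c.1 ζ j‖ ≤ ε / 2 * r * weight M.1 ζ := by
      intro ζ j
      have h1 : ‖c.1 ζ‖ / weight M.1 ζ ≤ ‖c‖ := by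
        rw [LInf.norm_eq]
        obtain ⟨K, hK⟩ := c.2
        exact le_ciSup (f := fun ζ => ‖c.1 ζ‖ / weight M.1 ζ)
          ⟨K, by rintro _ ⟨ζ, rfl⟩; exact hK ζ⟩ ζ
      rw [div_le_iff₀ (weight_pos M.2 ζ)] at h1
      exact (norm_le_pi_norm _ j).trans (h1.trans
        (mul_le_mul_of_nonneg_right hc (weight_pos M.2 ζ).le))
    have hmem : ((ε / 2 * r)⁻¹ : ℝ) • LInf.incl 𝕜 m M c ∈ boundedSet 𝕜 m n := by
      intro ζ j
      rw [toSeries_real_smul, Pi.smul_apply, Pi.smul_apply, norm_smul, norm_inv,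
        Real.norm_of_nonneg hδ.le, inv_mul_le_iff₀ hδ]
      refine (hcoef ζ j).trans (mul_le_mul_of_nonneg_left ?_ hδ.le)
      refine (weight_mono (le_of_lt M.2) hnM ζ).trans ?_
      unfold weight Series.bnd
      exact le_mul_of_one_le_left (by positivity) hn1
    have hU := real_mem hr hr0 (abs_of_pos hr0).le _ hmem
    rw [sub_zero]
    refine lt_of_le_of_lt (gauge_le_of_mem (half_pos hε).le ?_) (half_lt_self hε)
    refine ⟨_, hU, ?_⟩
    simp only [smul_smul]
    rw [show ε / 2 * (r * (ε / 2 * r)⁻¹) = 1 by field_simp, one_smul]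
  have hle : LCSeries.instTopologicalSpace 𝕜 m ≤ t := sInf_le hadm
  refine _root_.nhds_mono hle ?_
  rw [hp.mem_nhds_iff]
  refine ⟨{()}, 1, one_pos, fun c hcU => ?_⟩
  rw [Finset.sup_singleton, Seminorm.mem_ball_zero] at hcU
  exact setOfPred_gauge_lt_one_subset_self hc h0 habs hcU

theorem boundedSet_convex {n : ℕ} {x y : LCSeries 𝕜 m} (hx : x ∈ boundedSet 𝕜 m n)
    (hy : y ∈ boundedSet 𝕜 m n) {a b : ℝ} (ha : 0 ≤ a) (hb : 0 ≤ b) (hab : a + b = 1) :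
    a • x + b • y ∈ boundedSet 𝕜 m n := fun ζ j => by
  rw [toSeries_add, toSeries_real_smul, toSeries_real_smul]
  refine (norm_add_le _ _).trans ?_
  simp only [Pi.smul_apply, norm_smul, Real.norm_of_nonneg ha, Real.norm_of_nonneg hb]
  calc _ ≤ a * Series.bnd n ζ.length + b * Series.bnd n ζ.length :=
        add_le_add (mul_le_mul_of_nonneg_left (hx ζ j) ha) (mul_le_mul_of_nonneg_left (hy ζ j) hb)
    _ = _ := by rw [← add_mul, hab, one_mul]

theorem smul_mem_boundedSet {n : ℕ} {x : LCSeries 𝕜 m} (hx : x ∈ boundedSet 𝕜 m n) {r : 𝕜}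
    (hr : ‖r‖ ≤ 1) : r • x ∈ boundedSet 𝕜 m n := fun ζ j => by
  rw [toSeries_smul, Pi.smul_apply, Pi.smul_apply, norm_smul]
  exact (mul_le_of_le_one_left (norm_nonneg _) hr).trans (hx ζ j)

theorem zero_mem_boundedSet (n : ℕ) : (0 : LCSeries 𝕜 m) ∈ boundedSet 𝕜 m n := fun ζ j => by
  simpa using Series.bnd_nonneg n ζ.length

variable (𝕜 m) in
-- For `nhds`, the set of finite sums is balanced and convex, and it absorbs `boundedSet n` with
-- factor `ε n` through sums with a single term.
theorem isSilvaExhaustion : IsSilvaExhaustion 𝕜 (boundedSet 𝕜 m) where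
  compact := isCompact_boundedSet
  mono := boundedSet_mono
  zero_mem := zero_mem_boundedSet
  exhaust := exists_mem_boundedSet
  add n := ⟨2 * n, fun x hx y hy ζ j => (norm_add_le _ _).trans
    ((add_le_add (hx ζ j) (hy ζ j)).trans (bnd_add_bnd_le _ _))⟩
  smul _ _ hx _ hr := smul_mem_boundedSet hx hr
  nhds ε hε := by
    refine mem_nhds_zero_of_absorbs ?_ ?_ fun n => ⟨ε n, hε n, fun c hc => ?_⟩
    · rw [balanced_iff_smul_mem]
      rintro r hr _ ⟨N, b, hb, hb0, rfl⟩
      refine ⟨N, fun k => r • b k, fun k => smul_mem_boundedSet (hb k) hr, fun k hk => ?_, ?_⟩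
      · beta_reduce
        rw [hb0 k hk, smul_zero]
      · rw [Finset.smul_sum]
        exact Finset.sum_congr rfl fun k _ => smul_comm _ _ _
    · rintro _ ⟨N, b, hb, hb0, rfl⟩ _ ⟨N', b', hb', hb0', rfl⟩ s t hs ht hst
      refine ⟨max N N', fun k => s • b k + t • b' k,
        fun k => boundedSet_convex (hb k) (hb' k) hs ht hst, fun k hk => ?_, ?_⟩
      · beta_reduce
        rw [hb0 k (le_of_max_le_left hk), hb0' k (le_of_max_le_right hk), smul_zero, smul_zero,
          add_zero]
      · rw [sum_range_eq_of_le (le_max_left N N') ε hb0,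
          sum_range_eq_of_le (le_max_right N N') ε hb0', Finset.smul_sum, Finset.smul_sum,
          ← Finset.sum_add_distrib]
        refine Finset.sum_congr rfl fun k _ => ?_
        rw [smul_add, RCLike.real_smul_eq_coe_smul (K := 𝕜) s, RCLike.real_smul_eq_coe_smul (K := 𝕜) t,
          RCLike.real_smul_eq_coe_smul (K := 𝕜) s (b k), RCLike.real_smul_eq_coe_smul (K := 𝕜) t (b' k),
          smul_comm (s : 𝕜), smul_comm (t : 𝕜)]
    · refine ⟨n + 1, fun k => if k = n then c else 0, fun k => ?_, fun k hk => ?_, ?_⟩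
      · beta_reduce
        split_ifs with h
        · rwa [h]
        · exact zero_mem_boundedSet k
      · exact if_neg (by omega)
      · simp

end LCSeries

/-! ### Directional derivatives of maps with polynomial coefficients. -/

section Smoothness

variable {𝕜 : Type*} [RCLike 𝕜]

section DirDeriv

variable {E F : Type*} [AddCommGroup E] [Module 𝕜 E] [AddCommGroup F] [Module 𝕜 F]
  [TopologicalSpace F] [T2Space F]

theorem HasDirDeriv.dirDeriv_eq {f : E → F} {f' : F} {x v : E} (h : HasDirDeriv 𝕜 f f' x v) :
    dirDeriv 𝕜 f x v = f' := by
  have hex : ∃ f', HasDirDeriv 𝕜 f f' x v := ⟨f', h⟩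
  rw [dirDeriv, dif_pos hex]
  exact tendsto_nhds_unique hex.choose_spec h

end DirDeriv

variable {X σ : Type*} [AddCommGroup X] [Module 𝕜 X]

/-- Polynomial functions in the coordinates of a base point and of `k` directions, together with
a majorant: the polynomial with the norms of the coefficients. -/
inductive PolyMaj (κ : X →ₗ[𝕜] σ → 𝕜) (k : ℕ) :
    (X → (Fin k → X) → 𝕜) → ((σ → ℝ) → ℝ) → Prop
  | const (a : 𝕜) : PolyMaj κ k (fun _ _ => a) (fun _ => ‖a‖)
  | base (s : σ) : PolyMaj κ k (fun x _ => κ x s) (fun w => w s)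
  | dir (i : Fin k) (s : σ) : PolyMaj κ k (fun _ y => κ (y i) s) (fun w => w s)
  | add {p₁ p₂ : X → (Fin k → X) → 𝕜} {q₁ q₂ : (σ → ℝ) → ℝ} :
      PolyMaj κ k p₁ q₁ → PolyMaj κ k p₂ q₂ →
      PolyMaj κ k (fun x y => p₁ x y + p₂ x y) (fun w => q₁ w + q₂ w)
  | mul {p₁ p₂ : X → (Fin k → X) → 𝕜} {q₁ q₂ : (σ → ℝ) → ℝ} :
      PolyMaj κ k p₁ q₁ → PolyMaj κ k p₂ q₂ →
      PolyMaj κ k (fun x y => p₁ x y * p₂ x y) (fun w => q₁ w * q₂ w)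

namespace PolyMaj

variable {κ : X →ₗ[𝕜] σ → 𝕜} {k : ℕ} {p : X → (Fin k → X) → 𝕜} {q : (σ → ℝ) → ℝ}

theorem nonneg (h : PolyMaj κ k p q) {w : σ → ℝ} (hw : 0 ≤ w) : 0 ≤ q w := by
  induction h with
  | const a => exact norm_nonneg a
  | base s => exact hw s
  | dir i s => exact hw s
  | add _ _ h₁ h₂ => exact add_nonneg h₁ h₂
  | mul _ _ h₁ h₂ => exact mul_nonneg h₁ h₂

theorem mono (h : PolyMaj κ k p q) {w w' : σ → ℝ} (hw : 0 ≤ w) (hw' : w ≤ w') : q w ≤ q w' := by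
  induction h with
  | const a => exact le_rfl
  | base s => exact hw' s
  | dir i s => exact hw' s
  | add _ _ h₁ h₂ => exact add_le_add h₁ h₂
  | mul hp₁ hp₂ h₁ h₂ =>
    exact mul_le_mul h₁ h₂ (hp₂.nonneg hw) (hp₁.nonneg (hw.trans hw'))

theorem norm_le (h : PolyMaj κ k p q) {w : σ → ℝ} {x : X} {y : Fin k → X}
    (hx : ∀ s, ‖κ x s‖ ≤ w s) (hy : ∀ i s, ‖κ (y i) s‖ ≤ w s) : ‖p x y‖ ≤ q w := by
  have hw : 0 ≤ w := fun s => (norm_nonneg _).trans (hx s)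
  induction h with
  | const a => exact le_rfl
  | base s => exact hx s
  | dir i s => exact hy i s
  | add _ _ h₁ h₂ => exact (norm_add_le _ _).trans (add_le_add h₁ h₂)
  | mul hp₁ _ h₁ h₂ =>
    rw [norm_mul]
    exact mul_le_mul h₁ h₂ (norm_nonneg _) (hp₁.nonneg hw)

theorem continuous [TopologicalSpace X] (hκ : ∀ s, Continuous fun x => κ x s)
    (h : PolyMaj κ k p q) : Continuous fun z : X × (Fin k → X) => p z.1 z.2 := by
  induction h with
  | const a => exact continuous_const
  | base s => exact (hκ s).comp continuous_fst
  | dir i s => exact (hκ s).comp ((continuous_apply i).comp continuous_snd)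
  | add _ _ h₁ h₂ => exact h₁.add h₂
  | mul _ _ h₁ h₂ => exact h₁.mul h₂

theorem init (h : PolyMaj κ k p q) : PolyMaj κ (k + 1) (fun x y => p x (Fin.init y)) q := by
  induction h with
  | const a => exact const a
  | base s => exact base s
  | dir i s => exact dir i.castSucc s
  | add _ _ h₁ h₂ => exact h₁.add h₂
  | mul _ _ h₁ h₂ => exact h₁.mul h₂

/-- The increment in a direction is controlled by the increment of the majorant. -/
theorem norm_sub_le (h : PolyMaj κ k p q) {w : σ → ℝ} {x v : X} {y : Fin k → X}
    (hx : ∀ s, ‖κ x s‖ ≤ w s) (hv : ∀ s, ‖κ v s‖ ≤ w s) (hy : ∀ i s, ‖κ (y i) s‖ ≤ w s)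
    {t : 𝕜} (ht : ‖t‖ ≤ 1) :
    ‖p (x + t • v) y - p x y‖ ≤ ‖t‖ * (q (w + w) - q w) := by
  have hw : 0 ≤ w := fun s => (norm_nonneg _).trans (hx s)
  have hww : w ≤ w + w := le_add_of_nonneg_left hw
  have hx' : ∀ s, ‖κ (x + t • v) s‖ ≤ (w + w) s := fun s => by
    rw [map_add, map_smul, Pi.add_apply, Pi.smul_apply, smul_eq_mul]
    refine (norm_add_le _ _).trans (add_le_add (hx s) ?_)
    rw [norm_mul]
    exact (mul_le_of_le_one_left (norm_nonneg _) ht).trans (hv s)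
  have hy' : ∀ i s, ‖κ (y i) s‖ ≤ (w + w) s := fun i s => (hy i s).trans (hww s)
  induction h with
  | const a => simp
  | base s =>
    simp only [map_add, map_smul, Pi.add_apply, Pi.smul_apply, smul_eq_mul, add_sub_cancel_left,
      norm_mul]
    exact mul_le_mul_of_nonneg_left (hv s) (norm_nonneg t)
  | dir i s =>
    simpa using mul_nonneg (norm_nonneg t) (hw s)
  | add _ _ h₁ h₂ =>
    rw [add_sub_add_comm]
    refine (norm_add_le _ _).trans ((add_le_add h₁ h₂).trans (le_of_eq ?_))
    ring
  | @mul p₁ p₂ q₁ q₂ hp₁ hp₂ h₁ h₂ =>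
    have e : p₁ (x + t • v) y * p₂ (x + t • v) y - p₁ x y * p₂ x y =
        (p₁ (x + t • v) y - p₁ x y) * p₂ (x + t • v) y +
          p₁ x y * (p₂ (x + t • v) y - p₂ x y) := by ring
    rw [e]
    refine (norm_add_le _ _).trans ?_
    rw [norm_mul, norm_mul]
    have h3 := hp₂.norm_le hx' hy'
    have h4 := hp₁.norm_le hx hy
    have h5 : 0 ≤ ‖t‖ * (q₁ (w + w) - q₁ w) := (norm_nonneg _).trans h₁
    refine (add_le_add (mul_le_mul h₁ h3 (norm_nonneg _) h5)
      (mul_le_mul h4 h₂ (norm_nonneg _) (hp₁.nonneg hw))).trans (le_of_eq ?_)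
    ring

/-- A polynomial with nonnegative coefficients has derivative at `w` in direction `w` at most `q (w
+ w) - q w`. No constant depends on the degree, which is essential as the degrees of the
coefficients grow with the length of the word. -/
theorem exists_deriv (h : PolyMaj κ k p q) :
    ∃ (dp : X → (Fin (k + 1) → X) → 𝕜) (dq : (σ → ℝ) → ℝ), PolyMaj κ (k + 1) dp dq ∧
      (∀ x y, HasDerivAt (fun t : 𝕜 => p (x + t • y (Fin.last k)) (Fin.init y)) (dp x y) 0) ∧
      ∀ w : σ → ℝ, 0 ≤ w → dq w ≤ q (w + w) - q w := by
  induction h with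
  | const a =>
    exact ⟨_, _, const 0, fun x y => hasDerivAt_const _ _, fun w hw => by simp⟩
  | base s =>
    refine ⟨_, _, dir (Fin.last k) s, fun x y => ?_, fun w hw => by simp⟩
    simp only [map_add, map_smul, Pi.add_apply, Pi.smul_apply, smul_eq_mul]
    simpa using ((hasDerivAt_id (0 : 𝕜)).mul_const (κ (y (Fin.last k)) s)).const_add (κ x s)
  | dir i s =>
    exact ⟨_, _, const 0, fun x y => hasDerivAt_const _ _, fun w hw => by simpa using hw s⟩
  | add _ _ h₁ h₂ =>
    obtain ⟨dp₁, dq₁, hd₁, hD₁, hq₁⟩ := h₁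
    obtain ⟨dp₂, dq₂, hd₂, hD₂, hq₂⟩ := h₂
    refine ⟨_, _, hd₁.add hd₂, fun x y => (hD₁ x y).add (hD₂ x y), fun w hw => ?_⟩
    linarith [hq₁ w hw, hq₂ w hw]
  | @mul p₁ p₂ q₁ q₂ hp₁ hp₂ h₁ h₂ =>
    obtain ⟨dp₁, dq₁, hd₁, hD₁, hq₁⟩ := h₁
    obtain ⟨dp₂, dq₂, hd₂, hD₂, hq₂⟩ := h₂
    refine ⟨_, _, (hd₁.mul hp₂.init).add (hp₁.init.mul hd₂), fun x y => ?_, fun w hw => ?_⟩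
    · have h := (hD₁ x y).mul (hD₂ x y)
      simp only [zero_smul, add_zero] at h
      exact h
    · have h3 := hp₁.nonneg hw
      have h4 := hp₂.nonneg hw
      have h5 := hp₂.mono hw (le_add_of_nonneg_left hw)
      have h6 := hd₁.nonneg hw
      nlinarith [mul_le_mul (hq₁ w hw) h5 h4 (h6.trans (hq₁ w hw)),
        mul_le_mul_of_nonneg_left (hq₂ w hw) h3]

theorem zero : PolyMaj κ k (fun _ _ => 0) (fun _ => 0) := by
  simpa using const (κ := κ) (k := k) 0

theorem sum {ι : Type*} (s : Finset ι) {p : ι → X → (Fin k → X) → 𝕜} {q : ι → (σ → ℝ) → ℝ}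
    (h : ∀ i ∈ s, PolyMaj κ k (p i) (q i)) :
    PolyMaj κ k (fun x y => ∑ i ∈ s, p i x y) (fun w => ∑ i ∈ s, q i w) := by
  classical
  induction s using Finset.induction_on with
  | empty => simpa using zero
  | insert i s hi ih =>
    simp only [Finset.sum_insert hi]
    exact (h i (Finset.mem_insert_self i s)).add
      (ih fun j hj => h j (Finset.mem_insert_of_mem hj))

end PolyMaj

variable {m : ℕ}

/-- Maps into the space of locally convergent series whose coefficients are polynomials with
majorants which are bounded on bounded sets. -/
def IsTame (κ : X →ₗ[𝕜] σ → 𝕜) (W : ℕ → σ → ℝ) (k : ℕ) (f : X → (Fin k → X) → LCSeries 𝕜 m) :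
    Prop :=
  ∃ q : Word m → Fin m → (σ → ℝ) → ℝ,
    (∀ ζ j, PolyMaj κ k (fun x y => (f x y).toSeries ζ j) (q ζ j)) ∧
    ∀ n, ∃ n', ∀ ζ j, q ζ j (W n) ≤ Series.bnd n' ζ.length

/-- Coordinates on a topological vector space for which the boxes of size `W n` form a Silva
exhaustion. -/
structure IsSilvaCoord [TopologicalSpace X] (κ : X →ₗ[𝕜] σ → 𝕜) (W : ℕ → σ → ℝ) : Prop where
  exhaustion : IsSilvaExhaustion 𝕜 fun n => {x : X | ∀ s, ‖κ x s‖ ≤ W n s}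
  continuous : ∀ s, Continuous fun x => κ x s
  double : ∀ n s, W n s + W n s ≤ W (2 * n) s

namespace IsSilvaCoord

variable [TopologicalSpace X] [IsTopologicalAddGroup X] [ContinuousSMul 𝕜 X]
  {κ : X →ₗ[𝕜] σ → 𝕜} {W : ℕ → σ → ℝ} {k : ℕ}

/-- On a box of base points and directions the values lie in one bounded set, where convergence is
coefficientwise, and the coefficients are continuous polynomials. -/
theorem continuous_of_isTame (hX : IsSilvaCoord κ W) {f : X → (Fin k → X) → LCSeries 𝕜 m}
    (hf : IsTame κ W k f) : Continuous fun z : X × (Fin k → X) => f z.1 z.2 := by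
  obtain ⟨q, hq, hb⟩ := hf
  refine (hX.exhaustion.prod (hX.exhaustion.pi (ι := Fin k))).continuous_of_continuousOn
    fun n z hz => ?_
  obtain ⟨n', hn'⟩ := hb n
  have hmem : ∀ z ∈ {x : X | ∀ s, ‖κ x s‖ ≤ W n s} ×ˢ
      (Set.univ.pi fun _ : Fin k => {x : X | ∀ s, ‖κ x s‖ ≤ W n s}),
      f z.1 z.2 ∈ LCSeries.boundedSet 𝕜 m n' := fun z hz ζ j =>
    ((hq ζ j).norm_le hz.1 fun i => hz.2 i (Set.mem_univ i)).trans (hn' ζ j)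
  refine LCSeries.tendsto_of_coeff (n := n') ?_ (hmem z hz) fun ζ j => ?_
  · filter_upwards [self_mem_nhdsWithin] with z hz using hmem z hz
  · exact (((hq ζ j).continuous hX.continuous).tendsto z).mono_left nhdsWithin_le_nhds

/-- By `norm_sub_le` the difference quotients with `‖t‖ ≤ 1` stay in one bounded set. Convergence of
the coefficients is therefore convergence in the Silva topology. -/
theorem exists_deriv_of_isTame (hX : IsSilvaCoord κ W) {f : X → (Fin k → X) → LCSeries 𝕜 m}
    (hf : IsTame κ W k f) : ∃ df : X → (Fin (k + 1) → X) → LCSeries 𝕜 m,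
      IsTame κ W (k + 1) df ∧ ∀ x y,
        HasDirDeriv 𝕜 (fun z => f z (Fin.init y)) (df x y) x (y (Fin.last k)) := by
  obtain ⟨q, hq, hb⟩ := hf
  choose dp dq hd hD hdq using fun ζ j => (hq ζ j).exists_deriv
  have hW : ∀ n, 0 ≤ W n := fun n s => (norm_nonneg _).trans (hX.exhaustion.zero_mem n s)
  have hbound : ∀ n, ∃ n', ∀ ζ j, q ζ j (W n + W n) ≤ Series.bnd n' ζ.length := by
    intro n
    obtain ⟨n', hn'⟩ := hb (2 * n)
    exact ⟨n', fun ζ j =>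
      ((hq ζ j).mono (add_nonneg (hW n) (hW n)) (hX.double n)).trans (hn' ζ j)⟩
  have hdqle : ∀ n ζ j, dq ζ j (W n) ≤ q ζ j (W n + W n) := fun n ζ j =>
    (hdq ζ j _ (hW n)).trans (sub_le_self _ ((hq ζ j).nonneg (hW n)))
  have hex : ∀ (x : X) (y : Fin (k + 1) → X), ∃ n, (∀ s, ‖κ x s‖ ≤ W n s) ∧
      ∀ i s, ‖κ (y i) s‖ ≤ W n s := by
    intro x y
    obtain ⟨n, hn⟩ := (hX.exhaustion.prod (hX.exhaustion.pi (ι := Fin (k + 1)))).exhaust (x, y)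
    exact ⟨n, hn.1, fun i => hn.2 i (Set.mem_univ i)⟩
  choose n hnx hny using hex
  choose N hN using hbound
  have hdf : ∀ x y ζ j, ‖dp ζ j x y‖ ≤ Series.bnd (N (n x y)) ζ.length := fun x y ζ j =>
    ((hd ζ j).norm_le (hnx x y) (hny x y)).trans ((hdqle _ ζ j).trans (hN _ ζ j))
  -- The index depending on `x` and `y` only certifies local convergence and leaves no trace in the
  -- coefficients; tameness uses bounds uniform on boxes.
  refine ⟨fun x y => LCSeries.ofBounded (N (n x y)) (fun ζ j => dp ζ j x y) (hdf x y),
    ⟨dq, hd, fun n => ⟨N n, fun ζ j => (hdqle n ζ j).trans (hN n ζ j)⟩⟩, fun x y => ?_⟩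
  refine LCSeries.tendsto_of_coeff (n := N (n x y)) ?_ (hdf x y) fun ζ j => ?_
  · have hball : ∀ᶠ t : 𝕜 in 𝓝[≠] 0, ‖t‖ ≤ 1 := by
      refine Filter.Eventually.filter_mono nhdsWithin_le_nhds ?_
      filter_upwards [Metric.closedBall_mem_nhds (0 : 𝕜) one_pos] with t ht
      simpa using ht
    filter_upwards [hball, self_mem_nhdsWithin] with t ht ht0 ζ j
    have ht0 : t ≠ 0 := ht0
    rw [LCSeries.toSeries_smul, LCSeries.toSeries_sub, Pi.smul_apply, Pi.smul_apply, norm_smul,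
      norm_inv, inv_mul_le_iff₀ (norm_pos_iff.mpr ht0)]
    refine ((hq ζ j).norm_sub_le (hnx x y) (hny x y (Fin.last k))
      (fun i => hny x y i.castSucc) ht).trans ?_
    refine mul_le_mul_of_nonneg_left ?_ (norm_nonneg t)
    exact (sub_le_self _ ((hq ζ j).nonneg (hW _))).trans (hN _ ζ j)
  · have := (hD ζ j x y).tendsto_slope_zero
    simpa using this

theorem isTame_iterDirDeriv (hX : IsSilvaCoord κ W) {f : X → LCSeries 𝕜 m}
    (hf : IsTame κ W 0 fun x _ => f x) (k : ℕ) : IsTame κ W k (iterDirDeriv 𝕜 f k) := by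
  induction k with
  | zero => exact hf
  | succ k ih =>
    obtain ⟨df, hdf, h⟩ := hX.exists_deriv_of_isTame ih
    convert hdf using 1
    funext x y
    exact (h x y).dirDeriv_eq

theorem isSmoothOn_univ (hX : IsSilvaCoord κ W) {f : X → LCSeries 𝕜 m}
    (hf : IsTame κ W 0 fun x _ => f x) : IsSmoothOn 𝕜 f Set.univ where
  exists_deriv k y v x _ := by
    obtain ⟨df, -, h⟩ := hX.exists_deriv_of_isTame (hX.isTame_iterDirDeriv hf k)
    have := h x (Fin.snoc y v)
    rw [Fin.init_snoc, Fin.snoc_last] at this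
    exact ⟨_, this⟩
  continuousOn k := (hX.continuous_of_isTame (hX.isTame_iterDirDeriv hf k)).continuousOn

theorem continuous_of_isTame_zero (hX : IsSilvaCoord κ W) {f : X → LCSeries 𝕜 m}
    (hf : IsTame κ W 0 fun x _ => f x) : Continuous f :=
  (hX.continuous_of_isTame hf).comp (Continuous.prodMk continuous_id
    (continuous_const (y := (Fin.elim0 : Fin 0 → X))))

end IsSilvaCoord

end Smoothness

/-! ### Majorants of the series operations. -/

namespace PolyMaj

open Series

variable {𝕜 : Type*} [RCLike 𝕜] {X σ : Type*} [AddCommGroup X] [Module 𝕜 X] {m : ℕ}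
  {κ : X →ₗ[𝕜] σ → 𝕜} {k : ℕ}

/-- Shuffle multiplicities are nonnegative integers, so the majorant of a shuffle is the real
shuffle of the majorants. The same holds for the operations below, apart from the passage from `s`
to `‖s‖`. -/
theorem shuffle {a b : X → (Fin k → X) → ScalarSeries 𝕜 m} {A B : (σ → ℝ) → ScalarSeries ℝ m}
    {ζ : Word m}
    (ha : ∀ ξ : Word m, ξ.length ≤ ζ.length → PolyMaj κ k (fun x y => a x y ξ) fun w => A w ξ)
    (hb : ∀ ξ : Word m, ξ.length ≤ ζ.length → PolyMaj κ k (fun x y => b x y ξ) fun w => B w ξ) :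
    PolyMaj κ k (fun x y => Series.shuffle (a x y) (b x y) ζ)
      fun w => Series.shuffle (A w) (B w) ζ := by
  induction ζ generalizing a b A B with
  | nil =>
    simp only [shuffle_nil]
    exact (ha [] le_rfl).mul (hb [] le_rfl)
  | cons x ζ ih =>
    simp only [shuffle_cons]
    exact (ih (fun ξ hξ => ha (x :: ξ) (by simpa using hξ))
        fun ξ hξ => hb ξ (hξ.trans (by simp))).add
      (ih (fun ξ hξ => ha ξ (hξ.trans (by simp))) fun ξ hξ => hb (x :: ξ) (by simpa using hξ))

theorem component {d : X → (Fin k → X) → Series 𝕜 m} {D : (σ → ℝ) → Series ℝ m} {ζ : Word m}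
    (h : ∀ j, PolyMaj κ k (fun x y => d x y ζ j) fun w => D w ζ j) (i : Fin (m + 1)) :
    PolyMaj κ k (fun x y => Series.component (d x y) i ζ)
      fun w => Series.component (D w) i ζ := by
  refine Fin.cases ?_ (fun j => ?_) i
  · simpa using zero
  · exact h j

theorem comp {d : X → (Fin k → X) → Series 𝕜 m} {D : (σ → ℝ) → Series ℝ m} {n : ℕ}
    (hd : ∀ ξ : Word m, ξ.length < n → ∀ j, PolyMaj κ k (fun x y => d x y ξ j) fun w => D w ξ j)
    {ζ : Word m} (hζ : ζ.length ≤ n) {e : X → (Fin k → X) → ScalarSeries 𝕜 m}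
    {E : (σ → ℝ) → ScalarSeries ℝ m}
    (he : ∀ ξ, PolyMaj κ k (fun x y => e x y ξ) fun w => E w ξ) :
    PolyMaj κ k (fun x y => Series.comp (d x y) (e x y) ζ) fun w => Series.comp (D w) (E w) ζ := by
  obtain ⟨l, hl⟩ : ∃ l, ζ.length = l := ⟨_, rfl⟩
  induction l using Nat.strong_induction_on generalizing ζ e E with
  | _ l ih =>
  cases ζ with
  | nil => simpa only [comp_nil] using he []
  | cons x ζ =>
    rw [List.length_cons] at hζ hl
    have IH : ∀ i, ∀ ξ : Word m, ξ.length ≤ ζ.length →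
        PolyMaj κ k (fun x y => Series.comp (d x y) (lshift i (e x y)) ξ)
          fun w => Series.comp (D w) (lshift i (E w)) ξ := fun i ξ hξ =>
      ih ξ.length (by omega) (by omega) (fun η => he (i :: η)) rfl
    simp only [comp_cons]
    refine (IH x ζ le_rfl).add ?_
    split_ifs
    · exact sum _ fun i _ => shuffle (fun ξ hξ => component (hd ξ (by omega)) i) (IH i)
    · exact zero

theorem groupProd {c d : X → (Fin k → X) → Series 𝕜 m} {C D : (σ → ℝ) → Series ℝ m}
    (hc : ∀ ζ j, PolyMaj κ k (fun x y => c x y ζ j) fun w => C w ζ j)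
    (hd : ∀ ζ j, PolyMaj κ k (fun x y => d x y ζ j) fun w => D w ζ j) (ζ : Word m) (j : Fin m) :
    PolyMaj κ k (fun x y => Series.groupProd (c x y) (d x y) ζ j)
      fun w => Series.groupProd (C w) (D w) ζ j := by
  simp only [groupProd_eq, Pi.add_apply, mixedComp_apply]
  exact (hd ζ j).add (comp (fun ξ _ => hd ξ) le_rfl fun ξ => component (hc ξ) j.succ)

theorem fixSeries {c : X → (Fin k → X) → Series 𝕜 m} {C : (σ → ℝ) → Series ℝ m} (s : 𝕜)
    (hc : ∀ ζ j, PolyMaj κ k (fun x y => c x y ζ j) fun w => C w ζ j) (ζ : Word m) (j : Fin m) :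
    PolyMaj κ k (fun x y => Series.fixSeries s (c x y) ζ j)
      fun w => Series.fixSeries ‖s‖ (C w) ζ j := by
  obtain ⟨l, hl⟩ : ∃ l, ζ.length = l := ⟨_, rfl⟩
  induction l using Nat.strong_induction_on generalizing ζ j with
  | _ l ih =>
  simp only [fixSeries_apply _ _ ζ]
  exact (const s).mul (comp (fun ξ hξ j => ih ξ.length (hl ▸ hξ) ξ j rfl) le_rfl
    fun ξ => component (hc ξ) j.succ)

end PolyMaj

/-! ### Coordinates on products. -/

section Coordinates

variable {𝕜 : Type*} [RCLike 𝕜]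

/-- Coordinates on a product. -/
def prodCoord {X Y σ τ : Type*} [AddCommGroup X] [Module 𝕜 X] [AddCommGroup Y] [Module 𝕜 Y]
    (κ : X →ₗ[𝕜] σ → 𝕜) (μ : Y →ₗ[𝕜] τ → 𝕜) : X × Y →ₗ[𝕜] (σ ⊕ τ → 𝕜) where
  toFun z := Sum.elim (κ z.1) (μ z.2)
  map_add' a b := by
    funext s
    cases s <;> simp
  map_smul' r a := by
    funext s
    cases s <;> simp

theorem IsSilvaCoord.prod {X Y σ τ : Type*} [AddCommGroup X] [Module 𝕜 X] [AddCommGroup Y]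
    [Module 𝕜 Y] [TopologicalSpace X] [TopologicalSpace Y] {κ : X →ₗ[𝕜] σ → 𝕜}
    {μ : Y →ₗ[𝕜] τ → 𝕜} {W : ℕ → σ → ℝ} {V : ℕ → τ → ℝ} (hX : IsSilvaCoord κ W)
    (hY : IsSilvaCoord μ V) :
    IsSilvaCoord (prodCoord κ μ) fun n => Sum.elim (W n) (V n) where
  exhaustion := by
    convert hX.exhaustion.prod hY.exhaustion using 2 with n
    ext z
    exact Sum.forall
  continuous s := by
    cases s with
    | inl s => exact (hX.continuous s).comp continuous_fst
    | inr s => exact (hY.continuous s).comp continuous_snd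
  double n s := by
    cases s with
    | inl s => exact hX.double n s
    | inr s => exact hY.double n s

end Coordinates

/-! ### Smoothness of the group operations in the chart. -/

namespace LCSeries

open Series

variable {𝕜 : Type*} [RCLike 𝕜] {m : ℕ}

variable (𝕜 m) in
/-- The coefficients of a locally convergent series. -/
def coeffs : LCSeries 𝕜 m →ₗ[𝕜] (Word m × Fin m → 𝕜) where
  toFun c s := c.toSeries s.1 s.2
  map_add' _ _ := rfl
  map_smul' _ _ := rfl

/-- The sizes of the boxes `boundedSet`. -/
def boxSize (m n : ℕ) (s : Word m × Fin m) : ℝ := bnd n s.1.length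

variable (𝕜 m) in
theorem isSilvaCoord : IsSilvaCoord (coeffs 𝕜 m) (boxSize m) where
  exhaustion := by
    convert isSilvaExhaustion 𝕜 m using 2 with n
    ext c
    exact Prod.forall
  continuous s := continuous_coeff s.1 s.2
  double n s := bnd_add_bnd_le n s.1.length

theorem norm_boxSize_le (n : ℕ) (ζ : Word m) (j : Fin m) :
    ‖boxSize m n (ζ, j)‖ ≤ bnd n ζ.length :=
  (Real.norm_of_nonneg (bnd_nonneg _ _)).le

/-- The product of the group `δ + 𝕜^m_LC⟨⟨X⟩⟩` in the global chart. -/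
def mul (c d : LCSeries 𝕜 m) : LCSeries 𝕜 m :=
  ⟨Series.groupProd c.toSeries d.toSeries, by
    obtain ⟨n, hc⟩ := exists_mem_boundedSet c
    obtain ⟨n', hd⟩ := exists_mem_boundedSet d
    exact (ofBounded _ _ (norm_groupProd_le (boundedSet_mono (le_max_left n n') hc)
      (boundedSet_mono (le_max_right n n') hd))).2⟩

@[simp] theorem toSeries_mul (c d : LCSeries 𝕜 m) :
    (mul c d).toSeries = Series.groupProd c.toSeries d.toSeries := rfl

/-- The inversion of the group `δ + 𝕜^m_LC⟨⟨X⟩⟩` in the global chart. -/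
def inv (c : LCSeries 𝕜 m) : LCSeries 𝕜 m :=
  ⟨Series.fixSeries (-1) c.toSeries, by
    obtain ⟨n, hc⟩ := exists_mem_boundedSet c
    exact (ofBounded _ _ (norm_fixSeries_le (by simp) hc)).2⟩

variable (𝕜 m)

/-- At the box sizes the majorant is the group product of real series with coefficients `bnd n`, so
`norm_groupProd_le` over `ℝ` bounds it. -/
theorem isTame_mul : IsTame (prodCoord (coeffs 𝕜 m) (coeffs 𝕜 m))
    (fun n => Sum.elim (boxSize m n) (boxSize m n)) 0
    fun p _ => mul p.1 p.2 := by
  refine ⟨fun ζ j w => Series.groupProd (fun ζ j => w (Sum.inl (ζ, j)))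
    (fun ζ j => w (Sum.inr (ζ, j))) ζ j, fun ζ j => ?_, fun n => ⟨2 * growth m n, fun ζ j => ?_⟩⟩
  · exact PolyMaj.groupProd (fun ζ j => PolyMaj.base (Sum.inl (ζ, j)))
      (fun ζ j => PolyMaj.base (Sum.inr (ζ, j))) ζ j
  · exact (le_abs_self _).trans (norm_groupProd_le (norm_boxSize_le n) (norm_boxSize_le n) ζ j)

theorem isTame_inv : IsTame (coeffs 𝕜 m) (boxSize m) 0 fun c _ => inv c := by
  refine ⟨fun ζ j w => Series.fixSeries ‖(-1 : 𝕜)‖ (fun ζ j => w (ζ, j)) ζ j, fun ζ j => ?_,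
    fun n => ⟨growth m n, fun ζ j => ?_⟩⟩
  · exact PolyMaj.fixSeries (-1) (fun ζ j => PolyMaj.base (ζ, j)) ζ j
  · exact (le_abs_self _).trans (norm_fixSeries_le (by simp) (norm_boxSize_le n) ζ j)

theorem isTame_id : IsTame (coeffs 𝕜 m) (boxSize m) 0 fun c _ => c :=
  ⟨fun ζ j w => w (ζ, j), fun ζ j => PolyMaj.base (ζ, j), fun n => ⟨n, fun _ _ => le_rfl⟩⟩

theorem isSmoothOn_mul :
    IsSmoothOn 𝕜 (fun p : LCSeries 𝕜 m × LCSeries 𝕜 m => mul p.1 p.2) Set.univ :=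
  ((isSilvaCoord 𝕜 m).prod (isSilvaCoord 𝕜 m)).isSmoothOn_univ (isTame_mul 𝕜 m)

theorem continuous_mul :
    Continuous fun p : LCSeries 𝕜 m × LCSeries 𝕜 m => mul p.1 p.2 :=
  ((isSilvaCoord 𝕜 m).prod (isSilvaCoord 𝕜 m)).continuous_of_isTame_zero (isTame_mul 𝕜 m)

theorem isSmoothOn_inv : IsSmoothOn 𝕜 (inv : LCSeries 𝕜 m → LCSeries 𝕜 m) Set.univ :=
  (isSilvaCoord 𝕜 m).isSmoothOn_univ (isTame_inv 𝕜 m)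

theorem continuous_inv : Continuous (inv : LCSeries 𝕜 m → LCSeries 𝕜 m) :=
  (isSilvaCoord 𝕜 m).continuous_of_isTame_zero (isTame_inv 𝕜 m)

theorem isSmoothOn_id : IsSmoothOn 𝕜 (fun c : LCSeries 𝕜 m => c) Set.univ :=
  (isSilvaCoord 𝕜 m).isSmoothOn_univ (isTame_id 𝕜 m)

variable {𝕜 m}

theorem exists_hasDirDeriv_mul (x v : LCSeries 𝕜 m) :
    ∃ f', HasDirDeriv 𝕜 (fun y => mul x y) f' 0 v := by
  obtain ⟨f', hf'⟩ := (isSmoothOn_mul 𝕜 m).exists_deriv 0 Fin.elim0 (0, v) (x, 0) trivial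
  refine ⟨f', ?_⟩
  unfold HasDirDeriv at hf' ⊢
  simpa [iterDirDeriv] using hf'

/-- The derivative exists by joint smoothness, so by continuity of the coefficients it is found
coefficientwise from `hasDerivAt_comp`. -/
theorem toSeries_dirDeriv_mul (x v : LCSeries 𝕜 m) :
    (dirDeriv 𝕜 (fun y => mul x y) 0 v).toSeries =
      v.toSeries + Series.preLie x.toSeries v.toSeries := by
  obtain ⟨f', hf'⟩ := exists_hasDirDeriv_mul x v
  rw [hf'.dirDeriv_eq]
  funext ζ j
  have h1 := ((continuous_coeff ζ j).tendsto f').comp hf'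
  have h2 : HasDerivAt (fun t : 𝕜 => t * v.toSeries ζ j +
      comp (t • v.toSeries) (component x.toSeries j.succ) ζ)
      (v.toSeries ζ j + pre v.toSeries (component x.toSeries j.succ) ζ) 0 := by
    refine HasDerivAt.add ?_ (hasDerivAt_comp _ _ _)
    simpa using (hasDerivAt_id (0 : 𝕜)).mul_const (v.toSeries ζ j)
  refine tendsto_nhds_unique h1 ?_
  rw [Pi.add_apply, Pi.add_apply, preLie_apply]
  refine h2.tendsto_slope_zero.congr fun t => ?_
  simp [groupProd_eq, mixedComp_apply]

end LCSeries

/-! ### The Lie group and its bracket. -/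

namespace UnitalLC

open LCSeries

variable {𝕜 : Type*} [RCLike 𝕜] {m : ℕ}

variable (𝕜 m) in
/-- The group structure of `δ + 𝕜^m_LC⟨⟨X⟩⟩`. -/
abbrev group : Group (UnitalLC 𝕜 m) :=
  letI : Mul (UnitalLC 𝕜 m) := ⟨fun a b => ⟨LCSeries.mul a.tail b.tail⟩⟩
  letI : One (UnitalLC 𝕜 m) := ⟨⟨0⟩⟩
  letI : Inv (UnitalLC 𝕜 m) := ⟨fun a => ⟨LCSeries.inv a.tail⟩⟩
  -- A right unit and right inverses suffice, so the left-sided laws need no separate argument on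
  -- series.
  Group.ofRightAxioms
    (fun _ _ _ => UnitalLC.ext (toSeries_injective (Series.groupProd_assoc _ _ _)))
    (fun _ => UnitalLC.ext (toSeries_injective (Series.groupProd_zero _)))
    (fun _ => UnitalLC.ext (toSeries_injective (Series.groupProd_fixSeries _)))

section

attribute [local instance] group

theorem eq_of_mem_atlas {φ : OpenPartialHomeomorph (UnitalLC 𝕜 m) (LCSeries 𝕜 m)}
    (h : φ ∈ atlas (LCSeries 𝕜 m) (UnitalLC 𝕜 m)) :
    φ = (tailHomeo 𝕜 m).toOpenPartialHomeomorph :=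
  OpenPartialHomeomorph.singletonChartedSpace_mem_atlas_eq _ rfl φ h

variable (𝕜 m)

theorem isLocallyConvexLieGroup :
    IsLocallyConvexLieGroup 𝕜 (LCSeries 𝕜 m) (UnitalLC 𝕜 m) where
  t2 := (tailHomeo 𝕜 m).symm.t2Space
  topologicalGroup :=
    { continuous_mul := (tailHomeo 𝕜 m).symm.continuous.comp ((LCSeries.continuous_mul 𝕜 m).comp
        ((tailHomeo 𝕜 m).continuous.prodMap (tailHomeo 𝕜 m).continuous))
      continuous_inv := (tailHomeo 𝕜 m).symm.continuous.comp ((LCSeries.continuous_inv 𝕜 m).comp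
        (tailHomeo 𝕜 m).continuous) }
  smooth_transition φ hφ ψ hψ := by
    rw [eq_of_mem_atlas hφ, eq_of_mem_atlas hψ]
    convert isSmoothOn_id 𝕜 m using 1
    · rfl
    · exact Set.eq_univ_of_forall fun _ => ⟨trivial, trivial⟩
  smooth_mul φ hφ ψ hψ χ hχ := by
    rw [eq_of_mem_atlas hφ, eq_of_mem_atlas hψ, eq_of_mem_atlas hχ]
    convert isSmoothOn_mul 𝕜 m using 1
    · rfl
    · exact Set.eq_univ_of_forall fun _ => ⟨trivial, trivial, trivial⟩
  smooth_inv φ hφ ψ hψ := by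
    rw [eq_of_mem_atlas hφ, eq_of_mem_atlas hψ]
    convert isSmoothOn_inv 𝕜 m using 1
    · rfl
    · exact Set.eq_univ_of_forall fun _ => ⟨trivial, trivial⟩

variable {𝕜 m}

theorem toSeries_leftInvariantField (v x : LCSeries 𝕜 m) :
    (leftInvariantField 𝕜 (UnitalLC 𝕜 m) v x).toSeries =
      v.toSeries + Series.preLie x.toSeries v.toSeries :=
  toSeries_dirDeriv_mul x v

/-- The field `x ↦ w + x ◁ w` is affine, so its difference quotients at `0` are constant. -/
theorem toSeries_dirDeriv_leftInvariantField (v w : LCSeries 𝕜 m) :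
    (dirDeriv 𝕜 (leftInvariantField 𝕜 (UnitalLC 𝕜 m) w) 0 v).toSeries =
      Series.preLie v.toSeries w.toSeries := by
  let f := leftInvariantField 𝕜 (UnitalLC 𝕜 m) w
  have h : HasDirDeriv 𝕜 f (f v - w) 0 v := by
    refine tendsto_const_nhds.congr' ?_
    filter_upwards [self_mem_nhdsWithin] with t ht
    have ht : t ≠ 0 := ht
    apply toSeries_injective
    have h0 := Series.preLie_smul_left (0 : 𝕜) 0 w.toSeries
    simp only [zero_smul] at h0
    simp only [f, toSeries_sub, toSeries_smul, toSeries_leftInvariantField, zero_add,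
      toSeries_zero, Series.preLie_smul_left, h0, add_zero, add_sub_cancel_left]
    rw [inv_smul_smul₀ ht]
  rw [h.dirDeriv_eq, toSeries_sub, toSeries_leftInvariantField, add_sub_cancel_left]

theorem toSeries_lieGroupBracket (v w : LCSeries 𝕜 m) :
    (lieGroupBracket 𝕜 (UnitalLC 𝕜 m) v w).toSeries =
      Series.preLie v.toSeries w.toSeries - Series.preLie w.toSeries v.toSeries := by
  have hone : chartAt (LCSeries 𝕜 m) (1 : UnitalLC 𝕜 m) 1 = 0 := rfl
  have hval : ∀ v : LCSeries 𝕜 m, leftInvariantField 𝕜 (UnitalLC 𝕜 m) v 0 = v := by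
    intro v
    apply toSeries_injective
    have h0 := Series.preLie_smul_left (0 : 𝕜) 0 v.toSeries
    simp only [zero_smul] at h0
    rw [toSeries_leftInvariantField, toSeries_zero, h0, add_zero]
  rw [lieGroupBracket, vectorFieldBracket, hone, hval, hval, toSeries_sub,
    toSeries_dirDeriv_leftInvariantField, toSeries_dirDeriv_leftInvariantField]

variable (𝕜 m)

theorem isLieAlgebraBracket : IsLieAlgebraBracket 𝕜
    (lieGroupBracket 𝕜 (UnitalLC 𝕜 m) : LCSeries 𝕜 m → LCSeries 𝕜 m → LCSeries 𝕜 m) where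
  add_left u v w := toSeries_injective <| by
    simp only [toSeries_lieGroupBracket, toSeries_add, Series.preLie_add_left,
      Series.preLie_add_right]
    abel
  add_right u v w := toSeries_injective <| by
    simp only [toSeries_lieGroupBracket, toSeries_add, Series.preLie_add_left,
      Series.preLie_add_right]
    abel
  smul_left r u v := toSeries_injective <| by
    simp only [toSeries_lieGroupBracket, toSeries_smul, Series.preLie_smul_left,
      Series.preLie_smul_right, smul_sub]
  smul_right r u v := toSeries_injective <| by
    simp only [toSeries_lieGroupBracket, toSeries_smul, Series.preLie_smul_left,
      Series.preLie_smul_right, smul_sub]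
  self u := toSeries_injective <| by
    rw [toSeries_lieGroupBracket, sub_self, toSeries_zero]
  jacobi u v w := toSeries_injective <| by
    simp only [toSeries_add, toSeries_lieGroupBracket, toSeries_zero]
    exact Series.preLie_jacobi _ _ _

end

end UnitalLC

end

theorem mainTheorem10 (𝕜 : Type*) [RCLike 𝕜] (m : ℕ) :
    ∃ _ : Group (UnitalLC 𝕜 m),
      (1 : UnitalLC 𝕜 m) = ⟨0⟩ ∧
      (∀ c d : LCSeries 𝕜 m,
        ((⟨c⟩ * ⟨d⟩ : UnitalLC 𝕜 m).tail).toSeries = Series.groupProd c.toSeries d.toSeries) ∧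
      IsLocallyConvexLieGroup 𝕜 (LCSeries 𝕜 m) (UnitalLC 𝕜 m) ∧
      IsLieAlgebraBracket 𝕜
        (lieGroupBracket 𝕜 (UnitalLC 𝕜 m) : LCSeries 𝕜 m → LCSeries 𝕜 m → LCSeries 𝕜 m) ∧
      ∀ c d : LCSeries 𝕜 m,
        (lieGroupBracket 𝕜 (UnitalLC 𝕜 m) c d).toSeries =
          Series.preLie c.toSeries d.toSeries - Series.preLie d.toSeries c.toSeries :=
  ⟨UnitalLC.group 𝕜 m, rfl, fun _ _ => rfl, UnitalLC.isLocallyConvexLieGroup 𝕜 m,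
    UnitalLC.isLieAlgebraBracket 𝕜 m, UnitalLC.toSeries_lieGroupBracket⟩
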